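/- Let $k$ be a field and let $\mathsf E$ be a small $k$-linear category. For objects $x,y$ write $x\preceq y$ if there are $n\ge 1$ and objects $x=z_0,z_1,\dots,z_n=y$ with $\operatorname{Hom}_{\mathsf E}(z_{i-1},z_i)\neq 0$ for all $1\le i\le n$, and write $x\prec y$ if $x\preceq y$ and $y\not\preceq x$. Assume that $\mathsf E$ is *left strictly locally finite*, that is: (i) $\operatorname{Hom}_{\mathsf E}(x,y)$ is finite-dimensional for all $x,y\in\mathsf E$; (ii) the set $\{z : x\preceq z\preceq y\}$ is finite for all $x,y\in\mathsf E$; (iii) for every $y\in\mathsf E$ there is a finite set $X_y$ of objects $x\prec y$ such that every morphism $f\colon z\to y$ with $z\prec y$ can be written as a finite sum $f=\sum_{i=1}^n h_ig_i$ with $n\ge0$, $g_i\colon z\to x_i$, $h_i\colon x_i\to y$, $x_i\in X_y$. Let $\mathcal C_{\mathsf E}=\bigoplus_{x,y\in\mathsf E}\operatorname{Hom}_{\mathsf E}(x,y)^*$ be the coassociative counital coalgebra whose counit is evaluation at $\mathrm{id}_x$ on $\operatorname{Hom}_{\mathsf E}(x,x)^*$ and zero on $\operatorname{Hom}_{\mathsf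 E}(x,y)^*$ for $x\ne y$, and whose comultiplication maps $\operatorname{Hom}_{\mathsf E}(x,y)^*$ to $\bigoplus_{x\preceq z\preceq y}\operatorname{Hom}_{\mathsf E}(x,z)^*\otimes_k\operatorname{Hom}_{\mathsf E}(z,y)^*$ by the maps dual to composition. For $x\in\mathsf E$ let $\epsilon_x\colon\mathcal C_{\mathsf E}\to k$ be the projection onto $\operatorname{Hom}_{\mathsf E}(x,x)^*$ followed by evaluation at $\mathrm{id}_x$. A right $\mathcal C_{\mathsf E}$-comodule is a vector space $\mathcal N$ with a coassociative counital coaction $\nu\colon\mathcal N\to\mathcal N\otimes_k\mathcal C_{\mathsf E}$; it is *locally finite* if for every $x\in\mathsf E$ the image $\mathcal N_x$ of the operator $(\mathrm{id}\otimes\epsilon_x)\circ\nu$ on $\mathcal N$ is finite-dimensional. A left $\mathcal C_{\mathsf E}$-contramodule is a vector space $\mathfrak P$ with a linear map $\pi\colon\operatorname{Hom}_k(\mathcal C_{\mathsf E},\mathfrak P)\to\mathfrak P$ satisfying contraassociativity (with respect to the identification of $f\in\operatorname{Hom}_k(\mathcal C_{\mathsf E},\operatorname{Hom}_k(\mathcal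 C_{\mathsf E},\mathfrak P))$ with the map $u\otimes v\mapsto f(v)(u)$ in $\operatorname{Hom}_k(\mathcal C_{\mathsf E}\otimes_k\mathcal C_{\mathsf E},\mathfrak P)$) and contraunitality; it is *locally finite* if for every $x\in\mathsf E$ the image $\mathfrak P^x$ of the operator $p\mapsto\pi(c\mapsto\epsilon_x(c)p)$ on $\mathfrak P$ is finite-dimensional. For a right comodule $\mathcal N$, the dual vector space $\mathcal N^*=\operatorname{Hom}_k(\mathcal N,k)$ is a left contramodule with the contraaction $\operatorname{Hom}_k(\mathcal C_{\mathsf E},\mathcal N^*)\simeq(\mathcal N\otimes_k\mathcal C_{\mathsf E})^*\xrightarrow{\ \nu^*\ }\mathcal N^*$, and it is locally finite if $\mathcal N$ is. Then the category $\mathsf{Comod_{lf}}\text{--}\mathcal C_{\mathsf E}$ of locally finite right $\mathcal C_{\mathsf E}$-comodules and the category $\mathcal C_{\mathsf E}\text{--}\mathsf{Contra_{lf}}$ of locally finite left $\mathcal C_{\mathsf E}$-contramodules are abelian, and the vector space dualization functor $$(\mathsf{Comod_{lf}}\text{--}\mathcal C_{\mathsf E})^{\mathsf{op}}\longrightarrow\mathcal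 C_{\mathsf E}\text{--}\mathsf{Contra_{lf}},\qquad \mathcal N\longmapsto\mathcal N^*,$$ is an equivalence of categories. -/

import Mathlib

open CategoryTheory
open scoped TensorProduct DirectSum

universe u v w t

noncomputable section

/-! ### Locally finite linear categories -/

section LinearCategories

/-- `x ⪯ y`: there is a finite chain, of length at least one, of composable nonzero morphisms
from `x` to `y`. -/
def MorphLE {E : Type v} [Category.{w} E] [Preadditive E] (x y : E) : Prop :=
  Relation.TransGen (fun a b : E => ∃ f : a ⟶ b, f ≠ 0) x y

/-- `x ≺ y`: `x ⪯ y` but not `y ⪯ x`. -/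
def MorphLT {E : Type v} [Category.{w} E] [Preadditive E] (x y : E) : Prop :=
  MorphLE x y ∧ ¬ MorphLE y x

/-- A `k`-linear category is locally finite if its morphism spaces are finite-dimensional and all
the intervals of the preorder `⪯` on its objects are finite. -/
class LocallyFiniteCat (k : Type u) [Field k] (E : Type v) [Category.{w} E] [Preadditive E]
    [Linear k E] : Prop where
  finite_hom : ∀ x y : E, Module.Finite k (x ⟶ y)
  finite_interval : ∀ x y : E, {z : E | MorphLE x z ∧ MorphLE z y}.Finite

/-- Left strict local finiteness: every object `y` has a finite set `X` of objects strictly below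
it such that every morphism `z ⟶ y` with `z ≺ y` is a finite sum of composites `z ⟶ x i ⟶ y`
with all `x i` in `X`. -/
class LeftStrictlyLocallyFiniteCat (k : Type u) [Field k] (E : Type v) [Category.{w} E]
    [Preadditive E] [Linear k E] : Prop extends LocallyFiniteCat k E where
  exists_frontier : ∀ y : E, ∃ X : Set E, X.Finite ∧ (∀ x ∈ X, MorphLT x y) ∧
    ∀ z : E, MorphLT z y → ∀ f : z ⟶ y,
      ∃ (n : ℕ) (x : Fin n → E) (g : ∀ i, z ⟶ x i) (h : ∀ i, x i ⟶ y),
        (∀ i, x i ∈ X) ∧ f = ∑ i, g i ≫ h i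

end LinearCategories

/-! ### The coalgebra of a locally finite linear category -/

/-- The underlying vector space `⨁_{x, y} Hom(x, y)^*` of the coalgebra of a linear category. -/
def CatCoalg (k : Type u) [Field k] (E : Type v) [Category.{w} E] [Preadditive E]
    [Linear k E] : Type (max u v w) :=
  ⨁ p : E × E, Module.Dual k (p.1 ⟶ p.2)

namespace CatCoalg

variable (k : Type u) [Field k] {E : Type v} [Category.{w} E] [Preadditive E] [Linear k E]

instance : AddCommGroup (CatCoalg k E) :=
  inferInstanceAs (AddCommGroup (⨁ p : E × E, Module.Dual k (p.1 ⟶ p.2)))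

instance : Module k (CatCoalg k E) :=
  inferInstanceAs (Module k (⨁ p : E × E, Module.Dual k (p.1 ⟶ p.2)))

open Classical in
/-- The inclusion of the component `Hom(x, y)^*`. -/
def incl (x y : E) : Module.Dual k (x ⟶ y) →ₗ[k] CatCoalg k E :=
  DirectSum.lof k (E × E) (fun p => Module.Dual k (p.1 ⟶ p.2)) (x, y)

/-- The projection onto the component `Hom(x, y)^*`. -/
def proj (x y : E) : CatCoalg k E →ₗ[k] Module.Dual k (x ⟶ y) :=
  DirectSum.component k (E × E) (fun p => Module.Dual k (p.1 ⟶ p.2)) (x, y)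

open Classical in
/-- The linear map out of the coalgebra with given restrictions to the components. -/
def desc {W : Type*} [AddCommGroup W] [Module k W]
    (f : ∀ x y : E, Module.Dual k (x ⟶ y) →ₗ[k] W) : CatCoalg k E →ₗ[k] W :=
  DirectSum.toModule k (E × E) W (fun p => f p.1 p.2)

variable {k}

@[simp]
lemma desc_incl {W : Type*} [AddCommGroup W] [Module k W]
    (f : ∀ x y : E, Module.Dual k (x ⟶ y) →ₗ[k] W) (x y : E) (φ : Module.Dual k (x ⟶ y)) :
    desc k f (incl k x y φ) = f x y φ := by
  classical
  exact DirectSum.toModule_lof k (M := fun p : E × E => Module.Dual k (p.1 ⟶ p.2)) (x, y) φ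

lemma hom_ext {W : Type*} [AddCommGroup W] [Module k W] {f g : CatCoalg k E →ₗ[k] W}
    (h : ∀ (x y : E) (φ : Module.Dual k (x ⟶ y)), f (incl k x y φ) = g (incl k x y φ)) :
    f = g := by
  classical
  refine DirectSum.linearMap_ext k (M := fun p : E × E => Module.Dual k (p.1 ⟶ p.2)) ?_
  rintro ⟨x, y⟩
  exact LinearMap.ext (h x y)

variable (k)

/-- The functional `ε_x`: the projection onto `Hom(x, x)^*` followed by evaluation at the
identity morphism. -/
def counitAt (x : E) : CatCoalg k E →ₗ[k] k :=
  (Module.Dual.eval k (x ⟶ x) (𝟙 x)) ∘ₗ proj k x x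

open Classical in
/-- The counit: evaluation at the identity on the diagonal components `Hom(x, x)^*`, and zero on
the other components. -/
def counitMap : CatCoalg k E →ₗ[k] k :=
  desc k fun x y => if h : x = y then Module.Dual.eval k (x ⟶ y) (eqToHom h) else 0

variable {k} in
lemma counitMap_incl_self (x : E) (φ : Module.Dual k (x ⟶ x)) :
    counitMap k (incl k x x φ) = φ (𝟙 x) := by
  simp [counitMap]

variable {k} in
lemma counitMap_incl_of_ne {x y : E} (h : x ≠ y) (φ : Module.Dual k (x ⟶ y)) :
    counitMap k (incl k x y φ) = 0 := by
  simp [counitMap, h]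

section Comul

variable [LocallyFiniteCat k E]

instance finite_hom (x y : E) : Module.Finite k (x ⟶ y) := LocallyFiniteCat.finite_hom x y

/-- The component `Hom(x, y)^* → Hom(x, z)^* ⊗ Hom(z, y)^*` of the comultiplication: the dual map
of the composition map, under `(Hom(x, z) ⊗ Hom(z, y))^* ≃ Hom(x, z)^* ⊗ Hom(z, y)^*`. -/
def comulComp (x z y : E) : Module.Dual k (x ⟶ y) →ₗ[k]
    Module.Dual k (x ⟶ z) ⊗[k] Module.Dual k (z ⟶ y) :=
  (TensorProduct.dualDistribEquiv k (x ⟶ z) (z ⟶ y)).symm.toLinearMap ∘ₗ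
    (TensorProduct.lift (Linear.comp (S := k) x z y)).dualMap

/-- The finite interval `{z | x ⪯ z ⪯ y}`. -/
def interval (x y : E) : Finset E :=
  (LocallyFiniteCat.finite_interval (k := k) x y).toFinset

/-- The comultiplication, with restriction `Hom(x, y)^* → ⨁_{x ⪯ z ⪯ y} Hom(x, z)^* ⊗ Hom(z, y)^*`
to the component `Hom(x, y)^*`. -/
def comulMap : CatCoalg k E →ₗ[k] CatCoalg k E ⊗[k] CatCoalg k E :=
  desc k fun x y => ∑ z ∈ interval k x y,
    (TensorProduct.map (incl k x z) (incl k z y)) ∘ₗ comulComp k x z y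

variable {k}

lemma mem_interval {x y z : E} : z ∈ interval k x y ↔ MorphLE x z ∧ MorphLE z y := by
  simp [interval]

lemma dualDistrib_comulComp {x z y : E} (φ : Module.Dual k (x ⟶ y)) (g : x ⟶ z) (h : z ⟶ y) :
    TensorProduct.dualDistrib k (x ⟶ z) (z ⟶ y) (comulComp k x z y φ) (g ⊗ₜ h) = φ (g ≫ h) := by
  have : TensorProduct.dualDistrib k (x ⟶ z) (z ⟶ y) (comulComp k x z y φ) =
      (TensorProduct.lift (Linear.comp (S := k) x z y)).dualMap φ :=
    (TensorProduct.dualDistribEquiv k (x ⟶ z) (z ⟶ y)).apply_symm_apply _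
  rw [this]
  rfl

lemma dualDistrib_injective {A B : Type*} [AddCommGroup A] [Module k A] [AddCommGroup B]
    [Module k B] [Module.Finite k A] [Module.Finite k B] :
    Function.Injective (TensorProduct.dualDistrib k A B) :=
  (TensorProduct.dualDistribEquiv k A B).injective

lemma comulComp_eq_zero {x z y : E} (h : z ∉ interval k x y) (φ : Module.Dual k (x ⟶ y)) :
    comulComp k x z y φ = 0 := by
  apply dualDistrib_injective
  ext g f
  simp only [TensorProduct.AlgebraTensorModule.curry_apply, LinearMap.restrictScalars_self,
    TensorProduct.curry_apply, map_zero, LinearMap.zero_apply]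
  rw [dualDistrib_comulComp]
  by_cases hg : g = 0
  · simp [hg]
  by_cases hf : f = 0
  · simp [hf]
  exact absurd (mem_interval.2 ⟨.single ⟨g, hg⟩, .single ⟨f, hf⟩⟩) h

lemma dualDistrib_assoc {A B D : Type*} [AddCommGroup A] [Module k A] [AddCommGroup B]
    [Module k B] [AddCommGroup D] [Module k D] (r : Module.Dual k A ⊗[k] Module.Dual k B)
    (g : Module.Dual k D) (a : A) (b : B) (d : D) :
    TensorProduct.dualDistrib k A (B ⊗[k] D)
      ((TensorProduct.dualDistrib k B D).lTensor (Module.Dual k A)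
        (TensorProduct.assoc k _ _ _ (r ⊗ₜ[k] g))) (a ⊗ₜ (b ⊗ₜ d)) =
    TensorProduct.dualDistrib k A B r (a ⊗ₜ b) * g d := by
  induction r with
  | zero =>
    rw [TensorProduct.zero_tmul, LinearEquiv.map_zero]
    simp only [map_zero, LinearMap.zero_apply, zero_mul]
  | add s t hs ht =>
    simp only [TensorProduct.add_tmul, map_add, LinearMap.add_apply, hs, ht, add_mul]
  | tmul p q => simp [mul_assoc]

lemma comulComp_coassoc {x w z y : E} (φ : Module.Dual k (x ⟶ y)) :
    TensorProduct.assoc k _ _ _ ((comulComp k x w z).rTensor _ (comulComp k x z y φ)) =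
      (comulComp k w z y).lTensor _ (comulComp k x w y φ) := by
  have inj : Function.Injective
      ((TensorProduct.dualDistrib k (x ⟶ w) ((w ⟶ z) ⊗[k] (z ⟶ y))) ∘ₗ
        (TensorProduct.dualDistrib k (w ⟶ z) (z ⟶ y)).lTensor (Module.Dual k (x ⟶ w))) := by
    rw [LinearMap.coe_comp]
    exact dualDistrib_injective.comp
      (Module.Flat.lTensor_preserves_injective_linearMap _ dualDistrib_injective)
  apply inj
  ext a b c
  simp only [LinearMap.comp_apply, TensorProduct.AlgebraTensorModule.curry_apply,
    LinearMap.restrictScalars_self, TensorProduct.curry_apply]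
  have h1 : ∀ s : Module.Dual k (x ⟶ z) ⊗[k] Module.Dual k (z ⟶ y),
      TensorProduct.dualDistrib k (x ⟶ w) ((w ⟶ z) ⊗[k] (z ⟶ y))
        ((TensorProduct.dualDistrib k (w ⟶ z) (z ⟶ y)).lTensor (Module.Dual k (x ⟶ w))
          (TensorProduct.assoc k _ _ _ ((comulComp k x w z).rTensor _ s))) (a ⊗ₜ (b ⊗ₜ c)) =
      TensorProduct.dualDistrib k (x ⟶ z) (z ⟶ y) s ((a ≫ b) ⊗ₜ c) := by
    intro s
    induction s with
    | zero =>
      rw [LinearMap.map_zero, LinearEquiv.map_zero]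
      simp only [map_zero, LinearMap.zero_apply]
    | add s t hs ht => simp only [map_add, LinearMap.add_apply, hs, ht]
    | tmul f g =>
      rw [LinearMap.rTensor_tmul, TensorProduct.dualDistrib_apply, ← dualDistrib_comulComp]
      exact dualDistrib_assoc (comulComp k x w z f) g a b c
  have h2 : ∀ s : Module.Dual k (x ⟶ w) ⊗[k] Module.Dual k (w ⟶ y),
      TensorProduct.dualDistrib k (x ⟶ w) ((w ⟶ z) ⊗[k] (z ⟶ y))
        ((TensorProduct.dualDistrib k (w ⟶ z) (z ⟶ y)).lTensor (Module.Dual k (x ⟶ w))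
          ((comulComp k w z y).lTensor _ s)) (a ⊗ₜ (b ⊗ₜ c)) =
      TensorProduct.dualDistrib k (x ⟶ w) (w ⟶ y) s (a ⊗ₜ (b ≫ c)) := by
    intro s
    induction s with
    | zero => simp
    | add s t hs ht => simp only [map_add, LinearMap.add_apply, hs, ht]
    | tmul f g => simp [dualDistrib_comulComp]
  rw [h1, h2, dualDistrib_comulComp, dualDistrib_comulComp, Category.assoc]

lemma comulMap_incl (x y : E) (φ : Module.Dual k (x ⟶ y)) :
    comulMap k (incl k x y φ) = ∑ z ∈ interval k x y,
      TensorProduct.map (incl k x z) (incl k z y) (comulComp k x z y φ) := by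
  simp [comulMap]

/-- The sum defining the comultiplication may be taken over any larger finite set. -/
lemma comulMap_incl_of_subset (x y : E) (φ : Module.Dual k (x ⟶ y)) {s : Finset E}
    (hs : interval k x y ⊆ s) :
    comulMap k (incl k x y φ) = ∑ z ∈ s,
      TensorProduct.map (incl k x z) (incl k z y) (comulComp k x z y φ) := by
  rw [comulMap_incl]
  refine Finset.sum_subset hs fun z _ hz => ?_
  rw [comulComp_eq_zero hz, map_zero]

lemma comulMap_coassoc :
    (TensorProduct.assoc k (CatCoalg k E) (CatCoalg k E) (CatCoalg k E)).toLinearMap ∘ₗ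
      (comulMap k).rTensor (CatCoalg k E) ∘ₗ comulMap k =
    (comulMap k).lTensor (CatCoalg k E) ∘ₗ comulMap k := by
  refine hom_ext fun x y φ => ?_
  simp only [LinearMap.comp_apply, LinearEquiv.coe_coe]
  rw [comulMap_incl, map_sum, map_sum, map_sum]
  set I := interval k x y with hI
  have key : ∀ w z : E,
      TensorProduct.assoc k _ _ _ (TensorProduct.map
        (TensorProduct.map (incl k x w) (incl k w z)) (incl k z y)
          ((comulComp k x w z).rTensor _ (comulComp k x z y φ))) =
      TensorProduct.map (incl k x w) (TensorProduct.map (incl k w z) (incl k z y))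
          ((comulComp k w z y).lTensor _ (comulComp k x w y φ)) := by
    intro w z
    rw [← comulComp_coassoc, TensorProduct.map_map_assoc]
  have hl : ∀ z ∈ I, ∀ s : Module.Dual k (x ⟶ z) ⊗[k] Module.Dual k (z ⟶ y),
      (comulMap k).rTensor (CatCoalg k E) (TensorProduct.map (incl k x z) (incl k z y) s) =
      ∑ w ∈ I, TensorProduct.map
        (TensorProduct.map (incl k x w) (incl k w z)) (incl k z y)
          ((comulComp k x w z).rTensor _ s) := by
    intro z hz s
    have hsub : interval k x z ⊆ I := fun w hw => mem_interval.2
      ⟨(mem_interval.1 hw).1, (mem_interval.1 hw).2.trans (mem_interval.1 hz).2⟩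
    induction s with
    | zero => simp
    | add s t hs ht => simp only [map_add, hs, ht, Finset.sum_add_distrib]
    | tmul f g =>
      simp [comulMap_incl_of_subset x z f hsub, TensorProduct.sum_tmul]
  have hr : ∀ w ∈ I, ∀ s : Module.Dual k (x ⟶ w) ⊗[k] Module.Dual k (w ⟶ y),
      (comulMap k).lTensor (CatCoalg k E) (TensorProduct.map (incl k x w) (incl k w y) s) =
      ∑ z ∈ I, TensorProduct.map (incl k x w) (TensorProduct.map (incl k w z) (incl k z y))
          ((comulComp k w z y).lTensor _ s) := by
    intro w hw s
    have hsub : interval k w y ⊆ I := fun z hz => mem_interval.2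
      ⟨(mem_interval.1 hw).1.trans (mem_interval.1 hz).1, (mem_interval.1 hz).2⟩
    induction s with
    | zero => simp
    | add s t hs ht => simp only [map_add, hs, ht, Finset.sum_add_distrib]
    | tmul f g =>
      simp [comulMap_incl_of_subset w y g hsub, TensorProduct.tmul_sum]
  rw [Finset.sum_congr rfl fun z hz => by rw [hl z hz _, map_sum],
    Finset.sum_congr rfl fun w hw => hr w hw _, Finset.sum_comm]
  exact Finset.sum_congr rfl fun w _ => Finset.sum_congr rfl fun z _ => key w z

lemma comulMap_rTensor_counit :
    (counitMap k).rTensor (CatCoalg k E) ∘ₗ comulMap k = TensorProduct.mk k k (CatCoalg k E) 1 := by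
  classical
  refine hom_ext fun x y φ => ?_
  simp only [LinearMap.comp_apply, TensorProduct.mk_apply]
  rw [comulMap_incl_of_subset x y φ (Finset.subset_insert x _), map_sum,
    Finset.sum_eq_single_of_mem x (Finset.mem_insert_self _ _)]
  · have h : ∀ s : Module.Dual k (x ⟶ x) ⊗[k] Module.Dual k (x ⟶ y),
        (counitMap k).rTensor (CatCoalg k E) (TensorProduct.map (incl k x x) (incl k x y) s) =
        1 ⊗ₜ incl k x y (TensorProduct.dualDistrib k _ _ s ∘ₗ TensorProduct.mk k _ _ (𝟙 x)) := by
      intro s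
      induction s with
      | zero => simp
      | add s t hs ht =>
        simp only [map_add, hs, ht, LinearMap.add_comp, TensorProduct.tmul_add]
      | tmul f g =>
        have : TensorProduct.dualDistrib k (x ⟶ x) (x ⟶ y) (f ⊗ₜ g) ∘ₗ
            TensorProduct.mk k _ _ (𝟙 x) = f (𝟙 x) • g := by
          ext; simp
        rw [this]
        simp [counitMap_incl_self, TensorProduct.smul_tmul']
    rw [h]
    congr 2
    ext g
    simp [dualDistrib_comulComp]
  · intro z _ hz
    generalize comulComp k x z y φ = s
    induction s with
    | zero => simp
    | add s t hs ht => simp only [map_add, hs, ht, add_zero]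
    | tmul f g => simp [counitMap_incl_of_ne hz.symm]

lemma comulMap_lTensor_counit :
    (counitMap k).lTensor (CatCoalg k E) ∘ₗ comulMap k =
      (TensorProduct.mk k (CatCoalg k E) k).flip 1 := by
  classical
  refine hom_ext fun x y φ => ?_
  simp only [LinearMap.comp_apply, TensorProduct.mk_apply, LinearMap.flip_apply]
  rw [comulMap_incl_of_subset x y φ (Finset.subset_insert y _), map_sum,
    Finset.sum_eq_single_of_mem y (Finset.mem_insert_self _ _)]
  · have h : ∀ s : Module.Dual k (x ⟶ y) ⊗[k] Module.Dual k (y ⟶ y),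
        (counitMap k).lTensor (CatCoalg k E) (TensorProduct.map (incl k x y) (incl k y y) s) =
        incl k x y (TensorProduct.dualDistrib k _ _ s ∘ₗ
          (TensorProduct.mk k _ _).flip (𝟙 y)) ⊗ₜ 1 := by
      intro s
      induction s with
      | zero => simp
      | add s t hs ht =>
        simp only [map_add, hs, ht, LinearMap.add_comp, TensorProduct.add_tmul]
      | tmul f g =>
        have : TensorProduct.dualDistrib k (x ⟶ y) (y ⟶ y) (f ⊗ₜ g) ∘ₗ
            (TensorProduct.mk k _ _).flip (𝟙 y) = g (𝟙 y) • f := by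
          ext; simp [mul_comm]
        rw [this]
        simp [counitMap_incl_self, TensorProduct.smul_tmul]
    rw [h]
    congr 2
    ext g
    simp [dualDistrib_comulComp]
  · intro z _ hz
    generalize comulComp k x z y φ = s
    induction s with
    | zero => simp
    | add s t hs ht => simp only [map_add, hs, ht, add_zero]
    | tmul f g => simp [counitMap_incl_of_ne hz]

/-- The coalgebra of a locally finite linear category. -/
instance : Coalgebra k (CatCoalg k E) where
  comul := comulMap k
  counit := counitMap k
  coassoc := comulMap_coassoc
  rTensor_counit_comp_comul := comulMap_rTensor_counit
  lTensor_counit_comp_comul := comulMap_lTensor_counit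

end Comul

end CatCoalg

/-! ### Right comodules over a coalgebra -/

/-- A right comodule over a coalgebra `C`. -/
structure RightComod (k : Type u) [Field k] (C : Type v) [AddCommGroup C] [Module k C]
    [Coalgebra k C] where
  carrier : Type t
  [addCommGroup : AddCommGroup carrier]
  [module : Module k carrier]
  /-- The right coaction `N → N ⊗ C`. -/
  coact : carrier →ₗ[k] carrier ⊗[k] C
  coassoc : (TensorProduct.assoc k carrier C C).toLinearMap ∘ₗ coact.rTensor C ∘ₗ coact =
    (Coalgebra.comul (R := k) (A := C)).lTensor carrier ∘ₗ coact
  coact_counit : (TensorProduct.rid k carrier).toLinearMap ∘ₗ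
    (Coalgebra.counit (R := k) (A := C)).lTensor carrier ∘ₗ coact = LinearMap.id

namespace RightComod

variable {k : Type u} [Field k] {C : Type v} [AddCommGroup C] [Module k C] [Coalgebra k C]

attribute [instance] RightComod.addCommGroup RightComod.module

/-- A morphism of right comodules. -/
@[ext]
structure Hom (M N : RightComod.{u, v, t} k C) where
  toLinearMap : M.carrier →ₗ[k] N.carrier
  comm : N.coact ∘ₗ toLinearMap = toLinearMap.rTensor C ∘ₗ M.coact

instance : Category (RightComod.{u, v, t} k C) where
  Hom M N := Hom M N
  id M := ⟨LinearMap.id, by simp⟩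
  comp f g := ⟨g.toLinearMap ∘ₗ f.toLinearMap, by
    rw [← LinearMap.comp_assoc, g.comm, LinearMap.comp_assoc, f.comm, LinearMap.rTensor_comp,
      LinearMap.comp_assoc]⟩

/-- The action on a right comodule `N` of a linear functional `φ` on the coalgebra:
`N → N ⊗ C → N ⊗ k ≃ N`. -/
def act (N : RightComod.{u, v, t} k C) (φ : Module.Dual k C) : N.carrier →ₗ[k] N.carrier :=
  (TensorProduct.rid k N.carrier).toLinearMap ∘ₗ φ.lTensor N.carrier ∘ₗ N.coact

end RightComod

/-! ### Left contramodules over a coalgebra -/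

/-- A left contramodule over a coalgebra `C`. The contraassociativity axiom uses the
identification `Hom(C, Hom(C, P)) ≃ Hom(C ⊗ C, P)` under which `f` corresponds to
`u ⊗ v ↦ f v u`. -/
structure LeftContra (k : Type u) [Field k] (C : Type v) [AddCommGroup C] [Module k C]
    [Coalgebra k C] where
  carrier : Type t
  [addCommGroup : AddCommGroup carrier]
  [module : Module k carrier]
  /-- The left contraaction `Hom(C, P) → P`. -/
  contraact : (C →ₗ[k] carrier) →ₗ[k] carrier
  contraassoc : ∀ f : C →ₗ[k] C →ₗ[k] carrier,
    contraact (contraact ∘ₗ f) =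
      contraact (TensorProduct.lift f.flip ∘ₗ Coalgebra.comul (R := k) (A := C))
  contraunit : ∀ p : carrier,
    contraact ((Coalgebra.counit (R := k) (A := C)).smulRight p) = p

namespace LeftContra

variable {k : Type u} [Field k] {C : Type v} [AddCommGroup C] [Module k C] [Coalgebra k C]

attribute [instance] LeftContra.addCommGroup LeftContra.module

/-- A morphism of left contramodules. -/
@[ext]
structure Hom (P Q : LeftContra.{u, v, t} k C) where
  toLinearMap : P.carrier →ₗ[k] Q.carrier
  comm : ∀ f : C →ₗ[k] P.carrier,
    toLinearMap (P.contraact f) = Q.contraact (toLinearMap ∘ₗ f)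

instance : Category (LeftContra.{u, v, t} k C) where
  Hom P Q := Hom P Q
  id P := ⟨LinearMap.id, fun _ => rfl⟩
  comp f g := ⟨g.toLinearMap ∘ₗ f.toLinearMap, fun h => by
    rw [LinearMap.comp_apply, f.comm, g.comm, LinearMap.comp_assoc]⟩

/-- The action on a left contramodule `P` of a linear functional `φ` on the coalgebra:
`p ↦ π (c ↦ φ(c) p)`. -/
def act (P : LeftContra.{u, v, t} k C) (φ : Module.Dual k C) : P.carrier →ₗ[k] P.carrier :=
  P.contraact ∘ₗ LinearMap.smulRightₗ φ

end LeftContra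

/-! ### Dualization -/

namespace RightComod

variable {k : Type u} [Field k] {C : Type v} [AddCommGroup C] [Module k C] [Coalgebra k C]

/-- The contraaction on the dual of a right comodule: the composite
`Hom(C, N^*) ≃ (N ⊗ C)^* → N^*`, the second map being dual to the coaction. -/
def dualContraact (N : RightComod.{u, v, t} k C) :
    (C →ₗ[k] Module.Dual k N.carrier) →ₗ[k] Module.Dual k N.carrier where
  toFun f := N.coact.dualMap (TensorProduct.lift f.flip)
  map_add' f g := by
    rw [← map_add]
    congr 1
    ext
    simp
  map_smul' a f := by
    rw [← map_smul]
    congr 1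
    ext
    simp

lemma dualContraact_apply (N : RightComod.{u, v, t} k C) (f : C →ₗ[k] Module.Dual k N.carrier)
    (n : N.carrier) : N.dualContraact f n = TensorProduct.lift f.flip (N.coact n) := rfl

/-- The dual left contramodule `N^*` of a right comodule `N`. -/
def dual (N : RightComod.{u, v, max u t} k C) : LeftContra.{u, v, max u t} k C where
  carrier := Module.Dual k N.carrier
  contraact := N.dualContraact
  contraassoc f := by
    ext n
    rw [dualContraact_apply, dualContraact_apply]
    have h1 : ∀ s : N.carrier ⊗[k] C,
        TensorProduct.lift (N.dualContraact ∘ₗ f).flip s =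
        TensorProduct.lift (LinearMap.flip (TensorProduct.lift f.flip))
          (TensorProduct.assoc k _ _ _ (N.coact.rTensor C s)) := by
      intro s
      induction s with
      | zero => simp
      | add s t hs ht => simp only [map_add, hs, ht]
      | tmul m c =>
        rw [TensorProduct.lift.tmul, LinearMap.flip_apply, LinearMap.comp_apply,
          dualContraact_apply, LinearMap.rTensor_tmul]
        generalize N.coact m = r
        induction r with
        | zero => simp
        | add s t hs ht => simp only [map_add, hs, ht, TensorProduct.add_tmul]
        | tmul a b => simp
    have h2 : ∀ s : N.carrier ⊗[k] C,
        TensorProduct.lift (TensorProduct.lift f.flip ∘ₗ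
          Coalgebra.comul (R := k) (A := C)).flip s =
        TensorProduct.lift (LinearMap.flip (TensorProduct.lift f.flip))
          ((Coalgebra.comul (R := k) (A := C)).lTensor N.carrier s) := by
      intro s
      induction s with
      | zero => simp
      | add s t hs ht => simp only [map_add, hs, ht]
      | tmul m c => simp
    rw [h1, h2]
    exact congrArg _ (LinearMap.congr_fun N.coassoc n)
  contraunit p := by
    ext n
    rw [dualContraact_apply]
    have h : ∀ s : N.carrier ⊗[k] C,
        TensorProduct.lift ((Coalgebra.counit (R := k) (A := C)).smulRight p).flip s =
        p (TensorProduct.rid k N.carrier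
          ((Coalgebra.counit (R := k) (A := C)).lTensor N.carrier s)) := by
      intro s
      induction s with
      | zero => simp
      | add s t hs ht => simp only [map_add, hs, ht]
      | tmul m c => simp
    rw [h]
    exact congrArg p (LinearMap.congr_fun N.coact_counit n)

lemma dualMap_dualContraact {M N : RightComod.{u, v, t} k C} (g : Hom M N)
    (f : C →ₗ[k] Module.Dual k N.carrier) :
    g.toLinearMap.dualMap (N.dualContraact f) =
      M.dualContraact (g.toLinearMap.dualMap ∘ₗ f) := by
  ext m
  have h1 : ∀ s : M.carrier ⊗[k] C, TensorProduct.lift (g.toLinearMap.dualMap ∘ₗ f).flip s =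
      TensorProduct.lift f.flip (g.toLinearMap.rTensor C s) := by
    intro s
    induction s with
    | zero => simp
    | add s t hs ht => simp only [map_add, hs, ht]
    | tmul m c => simp
  rw [LinearMap.dualMap_apply, dualContraact_apply, dualContraact_apply, h1]
  exact congrArg _ (LinearMap.congr_fun g.comm m)

/-- The morphism `g^* : N^* → M^*` dual to a morphism `g : M → N` of right comodules. -/
def Hom.dual {M N : RightComod.{u, v, max u t} k C} (g : Hom M N) :
    LeftContra.Hom (RightComod.dual.{u, v, t} N) (RightComod.dual.{u, v, t} M) where
  toLinearMap := g.toLinearMap.dualMap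
  comm := dualMap_dualContraact g

/-- The vector space dualization functor `N ↦ N^*`, from right comodules to left contramodules. -/
def dualFunctor (k : Type u) [Field k] (C : Type v) [AddCommGroup C] [Module k C]
    [Coalgebra k C] : (RightComod.{u, v, max u t} k C)ᵒᵖ ⥤ LeftContra.{u, v, max u t} k C where
  obj N := RightComod.dual.{u, v, t} N.unop
  map g := Hom.dual.{u, v, t} g.unop

lemma dual_act (N : RightComod.{u, v, max u t} k C) (φ : Module.Dual k C) :
    N.dual.act φ = (N.act φ).dualMap := by
  refine LinearMap.ext fun (p : Module.Dual k N.carrier) => LinearMap.ext fun n => ?_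
  change TensorProduct.lift (φ.smulRight p).flip (N.coact n) =
    p (TensorProduct.rid k N.carrier (φ.lTensor N.carrier (N.coact n)))
  generalize N.coact n = s
  induction s with
  | zero => simp
  | add s t hs ht => simp only [map_add, hs, ht]
  | tmul m c => simp

end RightComod

/-! ### Locally finite comodules and contramodules over the coalgebra of a category -/

lemma finiteDimensional_range_dualMap {k V : Type*} [Field k] [AddCommGroup V] [Module k V]
    (e : V →ₗ[k] V) (h : FiniteDimensional k (LinearMap.range e)) :
    FiniteDimensional k (LinearMap.range e.dualMap) := by
  have h' : e.dualMap = e.rangeRestrict.dualMap ∘ₗ (LinearMap.range e).subtype.dualMap :=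
    LinearMap.ext fun _ => rfl
  rw [h']
  exact Submodule.finiteDimensional_of_le (LinearMap.range_comp_le_range _ _)

section LocallyFinite

variable (k : Type u) [Field k] (E : Type v) [Category.{w} E] [Preadditive E] [Linear k E]
  [LocallyFiniteCat k E]

variable {k E} in
/-- The component `N_x` of a right comodule `N`: the image of the operator `ε_x`. -/
def RightComod.component (N : RightComod.{u, max u v w, t} k (CatCoalg k E)) (x : E) :
    Submodule k N.carrier :=
  LinearMap.range (N.act (CatCoalg.counitAt k x))

variable {k E} in
/-- The component `P^x` of a left contramodule `P`: the image of the operator `ε_x`. -/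
def LeftContra.component (P : LeftContra.{u, max u v w, t} k (CatCoalg k E)) (x : E) :
    Submodule k P.carrier :=
  LinearMap.range (P.act (CatCoalg.counitAt k x))

/-- A right comodule is locally finite if all its components are finite-dimensional. -/
def IsLocallyFiniteRightComod :
    ObjectProperty (RightComod.{u, max u v w, t} k (CatCoalg k E)) :=
  fun N => ∀ x : E, FiniteDimensional k (N.component x)

/-- A left contramodule is locally finite if all its components are finite-dimensional. -/
def IsLocallyFiniteLeftContra :
    ObjectProperty (LeftContra.{u, max u v w, t} k (CatCoalg k E)) :=
  fun P => ∀ x : E, FiniteDimensional k (P.component x)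

/-- The full subcategory of locally finite right comodules. -/
abbrev LFRightComod := (IsLocallyFiniteRightComod.{u, v, w, t} k E).FullSubcategory

/-- The full subcategory of locally finite left contramodules. -/
abbrev LFLeftContra := (IsLocallyFiniteLeftContra.{u, v, w, t} k E).FullSubcategory

variable {k E} in
lemma IsLocallyFiniteRightComod.dual {N : RightComod.{u, max u v w, max u t} k (CatCoalg k E)}
    (hN : IsLocallyFiniteRightComod.{u, v, w, max u t} k E N) :
    IsLocallyFiniteLeftContra.{u, v, w, max u t} k E (RightComod.dual.{u, max u v w, t} N) := by
  intro x
  have hx : FiniteDimensional k (LinearMap.range (N.act (CatCoalg.counitAt k x))) := hN x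
  rw [LeftContra.component, RightComod.dual_act]
  exact finiteDimensional_range_dualMap _ hx

/-- The dualization functor `N ↦ N^*` from locally finite right comodules to locally finite left
contramodules. -/
def lfDualFunctor :
    (LFRightComod.{u, v, w, max u t} k E)ᵒᵖ ⥤ LFLeftContra.{u, v, w, max u t} k E :=
  (IsLocallyFiniteLeftContra.{u, v, w, max u t} k E).lift
    ((IsLocallyFiniteRightComod.{u, v, w, max u t} k E).ι.op ⋙
      RightComod.dualFunctor.{u, max u v w, t} k (CatCoalg k E))
    (fun N => IsLocallyFiniteRightComod.dual.{u, v, w, t} N.unop.property)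

end LocallyFinite

end

noncomputable section

/-! ### Blocks of the coalgebra and evaluation functionals on them. -/

namespace CatCoalg

variable {k : Type u} [Field k] {E : Type v} [Category.{w} E] [Preadditive E] [Linear k E]

/-! The functionals ε_x are orthogonal idempotents for the convolution product on the dual of the
coalgebra. They exhibit a comodule as the sum of its components (`iSup_component_eq_top`) and a
contramodule as the product of its components (`eq_zero_of_act_counitAt`, `exists_act_counitAt_eq`),
and all morphisms respect them. Finite-dimensional components are reflexive, so a contramodule
morphism N^* → M^* is the transpose of a linear map M → N; testing against functionals on N ⊗ C
shows that this map is a comodule morphism. This is full faithfulness (`exists_dual_eq`,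
`dual_injective`).

For essential surjectivity, the candidate comodule for a contramodule P is `predual`, the span of
the functionals on P that factor through one component. It acquires a coaction once each such
functional, composed with the contraaction π, is represented by an element of the tensor product
with C. What is needed is that the y-component of π(F) depends on F only through finitely many
blocks Hom(z, y)^*. This is `exists_finset_contraact_eq_zero`, the one place where strictness
enters.

Its proof is a Nakayama-type argument. The values of π on families supported on the blocks Hom(z,
y)^* with z outside a finite set S form a decreasing system of subspaces of P^y, which stabilises by
finite-dimensionality. Dually to the factorization of morphisms through X_y, the blocks Hom(z, y)^*
with z outside a finite set embed into the sum over x in X_y of Hom(z, x)^* ⊗ Hom(x, y)^*.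
Contraassociativity then writes an element of the stable subspace at y as π of a family with values
in the stable subspaces at the x in X_y (`stableTail_le_map_frontierMaps`). Iterating this forever
and summing all the stages into one map q, which makes sense because ascending chains below a fixed
object are finite, gives π(q) = π(q − F) for an F with π(F) = p. Hence p = 0 (`stableTail_eq_bot`).

Comodules form an abelian category with kernels and cokernels computed on vector spaces, and local
finiteness passes to subobjects, quotients and finite products. Abelianness on the contramodule side
is transported along the equivalence. -/

@[simp]
lemma proj_incl_self (x y : E) (φ : Module.Dual k (x ⟶ y)) : proj k x y (incl k x y φ) = φ := by
  classical
  exact DirectSum.component.lof_self k (M := fun p : E × E => Module.Dual k (p.1 ⟶ p.2)) (x, y) φ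

lemma proj_incl_of_ne {x y a b : E} (h : ¬ (a = x ∧ b = y)) (φ : Module.Dual k (a ⟶ b)) :
    proj k x y (incl k a b φ) = 0 := by
  classical
  have h' : (a, b) ≠ (x, y) := fun e => h (Prod.mk.inj e)
  change (DirectSum.lof k (E × E) (fun p => Module.Dual k (p.1 ⟶ p.2)) (a, b) φ) (x, y) = 0
  rw [DirectSum.lof_eq_of]
  exact DirectSum.of_eq_of_ne _ _ _ h'.symm

/-- Evaluation of the component in `Hom(x, y)^*` at a morphism `g : x ⟶ y`. -/
def ev {x y : E} (g : x ⟶ y) : CatCoalg k E →ₗ[k] k :=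
  Module.Dual.eval k (x ⟶ y) g ∘ₗ proj k x y

@[simp]
lemma ev_incl_self {x y : E} (g : x ⟶ y) (φ : Module.Dual k (x ⟶ y)) :
    ev (k := k) g (incl k x y φ) = φ g := by
  simp [ev]

lemma ev_incl_of_ne {x y a b : E} (g : x ⟶ y) (h : ¬ (a = x ∧ b = y))
    (φ : Module.Dual k (a ⟶ b)) : ev (k := k) g (incl k a b φ) = 0 := by
  simp [ev, proj_incl_of_ne h]

lemma counitAt_eq_ev (x : E) : counitAt k x = ev (𝟙 x) := rfl

@[simp]
lemma ev_zero (x y : E) : ev (k := k) (0 : x ⟶ y) = 0 := by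
  ext; simp [ev]

@[simp]
lemma ev_add {x y : E} (f g : x ⟶ y) : ev (k := k) (f + g) = ev f + ev g := by
  ext; simp [ev]

lemma ev_sum {ι : Type*} (s : Finset ι) {x y : E} (f : ι → (x ⟶ y)) :
    ev (k := k) (∑ i ∈ s, f i) = ∑ i ∈ s, ev (f i) := by
  classical
  induction s using Finset.induction_on with
  | empty => simp
  | insert i s hi ih => rw [Finset.sum_insert hi, Finset.sum_insert hi, ev_add, ih]

lemma eq_zero_of_ev {c : CatCoalg k E} (h : ∀ (x y : E) (g : x ⟶ y), ev g c = 0) : c = 0 := by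
  refine DFinsupp.ext fun p => LinearMap.ext fun g => ?_
  exact h p.1 p.2 g

lemma ext_ev {c d : CatCoalg k E} (h : ∀ (x y : E) (g : x ⟶ y), ev g c = ev g d) : c = d := by
  rw [← sub_eq_zero]
  exact eq_zero_of_ev fun x y g => by rw [map_sub, h, sub_self]

open Classical in
/-- The projection of the coalgebra onto the sum of the components `Hom(a, b)^*` with `T a b`. -/
def sel (k : Type u) [Field k] {E : Type v} [Category.{w} E] [Preadditive E] [Linear k E]
    (T : E → E → Prop) : CatCoalg k E →ₗ[k] CatCoalg k E :=
  desc k fun a b => if T a b then incl k a b else 0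

lemma sel_incl {T : E → E → Prop} {a b : E} (h : T a b) (φ : Module.Dual k (a ⟶ b)) :
    sel k T (incl k a b φ) = incl k a b φ := by
  simp [sel, h]

lemma sel_incl_of_not {T : E → E → Prop} {a b : E} (h : ¬ T a b) (φ : Module.Dual k (a ⟶ b)) :
    sel k T (incl k a b φ) = 0 := by
  simp [sel, h]

lemma ev_comp_sel {T : E → E → Prop} {a b : E} (h : T a b) (g : a ⟶ b) :
    ev g ∘ₗ sel k T = ev g := by
  refine hom_ext fun x y φ => ?_
  by_cases hT : T x y
  · simp [sel_incl hT]
  · have : ¬ (x = a ∧ y = b) := by rintro ⟨rfl, rfl⟩; exact hT h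
    simp [sel_incl_of_not hT, ev_incl_of_ne g this]

lemma ev_comp_sel_of_not {T : E → E → Prop} {a b : E} (h : ¬ T a b) (g : a ⟶ b) :
    ev g ∘ₗ sel k T = 0 := by
  refine hom_ext fun x y φ => ?_
  by_cases hT : T x y
  · have : ¬ (x = a ∧ y = b) := by rintro ⟨rfl, rfl⟩; exact h hT
    simp [sel_incl hT, ev_incl_of_ne g this]
  · simp [sel_incl_of_not hT]

lemma sel_comp_sel (T U : E → E → Prop) :
    sel k T ∘ₗ sel k U = sel k fun a b => T a b ∧ U a b := by
  refine hom_ext fun x y φ => ?_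
  by_cases hT : T x y <;> by_cases hU : U x y <;>
    simp [sel, hT, hU]

lemma counitAt_comp_sel (y : E) :
    counitAt k y ∘ₗ sel k (fun _ b => b = y) = counitAt k y :=
  ev_comp_sel (T := fun _ b => b = y) rfl _

section Comul

variable [LocallyFiniteCat k E]

/-- The comultiplication is dual to the composition. -/
lemma ev_ev_comul {x z y : E} (g : x ⟶ z) (h : z ⟶ y) (c : CatCoalg k E) :
    TensorProduct.lid k k (TensorProduct.map (ev g) (ev h) (Coalgebra.comul (R := k) c)) =
      ev (g ≫ h) c := by
  classical
  change ((TensorProduct.lid k k).toLinearMap ∘ₗ TensorProduct.map (ev g) (ev h) ∘ₗ comulMap k) c =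
    _
  congr 1
  refine hom_ext fun a b φ => ?_
  simp only [LinearMap.comp_apply, LinearEquiv.coe_coe]
  -- Adjoining `z` to the index set avoids splitting on whether `z` lies in the interval: outside it
  -- the component of the comultiplication vanishes.
  rw [comulMap_incl_of_subset a b φ (Finset.subset_insert z _), map_sum, map_sum,
    Finset.sum_eq_single_of_mem z (Finset.mem_insert_self _ _)]
  · by_cases hab : a = x ∧ b = y
    · obtain ⟨rfl, rfl⟩ := hab
      rw [ev_incl_self, ← dualDistrib_comulComp]
      generalize comulComp k a z b φ = s
      induction s with
      | zero => simp
      | add s t hs ht => simp only [map_add, hs, ht, LinearMap.add_apply]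
      | tmul f g => simp
    · rw [ev_incl_of_ne _ hab]
      generalize comulComp k a z b φ = s
      induction s with
      | zero => simp
      | add s t hs ht => simp only [map_add, hs, ht, add_zero]
      | tmul f f' =>
        by_cases ha : a = x
        · have : ¬ (z = z ∧ b = y) := fun e => hab ⟨ha, e.2⟩
          simp [ev_incl_of_ne _ this]
        · have : ¬ (a = x ∧ z = z) := fun e => ha e.1
          simp [ev_incl_of_ne _ this]
  · intro w _ hw
    have : ¬ (w = z ∧ b = y) := fun e => hw e.1
    generalize comulComp k a w b φ = s
    induction s with
    | zero => simp
    | add s t hs ht => simp only [map_add, hs, ht, add_zero]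
    | tmul f f' => simp [ev_incl_of_ne _ this]

/-- Both tensor factors of every term of the comultiplication share the same middle object. -/
lemma ev_ev_comul_of_ne {x z z' y : E} (hz : z ≠ z') (g : x ⟶ z) (h : z' ⟶ y) (c : CatCoalg k E) :
    TensorProduct.lid k k (TensorProduct.map (ev g) (ev h) (Coalgebra.comul (R := k) c)) = 0 := by
  change ((TensorProduct.lid k k).toLinearMap ∘ₗ TensorProduct.map (ev g) (ev h) ∘ₗ comulMap k) c =
    (0 : CatCoalg k E →ₗ[k] k) c
  congr 1
  refine hom_ext fun a b φ => ?_
  simp only [LinearMap.comp_apply, LinearEquiv.coe_coe]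
  rw [comulMap_incl, map_sum, map_sum]
  refine Finset.sum_eq_zero fun w _ => ?_
  generalize comulComp k a w b φ = s
  induction s with
  | zero => simp
  | add s t hs ht => simp only [map_add, hs, ht, add_zero]
  | tmul f f' =>
    by_cases hw : w = z
    · have : ¬ (w = z' ∧ b = y) := fun e => hz (hw.symm.trans e.1)
      simp [ev_incl_of_ne _ this]
    · have : ¬ (a = x ∧ w = z) := fun e => hw e.2
      simp [ev_incl_of_ne _ this]

/-- Dual to `𝟙 x ≫ g = g`: contracting the left factor with ε_x keeps exactly the blocks with source
`x`. The companion below selects by target. -/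
lemma counitAt_rTensor_comul (x : E) (c : CatCoalg k E) :
    TensorProduct.lid k _ ((counitAt k x).rTensor _ (Coalgebra.comul (R := k) c)) =
      sel k (fun a _ => a = x) c := by
  refine ext_ev fun a b g => ?_
  have h1 : ∀ s : CatCoalg k E ⊗[k] CatCoalg k E,
      ev g (TensorProduct.lid k _ ((counitAt k x).rTensor _ s)) =
      TensorProduct.lid k k (TensorProduct.map (ev (𝟙 x)) (ev g) s) := by
    intro s
    induction s with
    | zero => simp
    | add s t hs ht => simp only [map_add, hs, ht]
    | tmul f f' => simp [counitAt_eq_ev]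
  rw [h1]
  by_cases h : x = a
  · subst h
    rw [ev_ev_comul, Category.id_comp]
    exact (LinearMap.congr_fun (ev_comp_sel (T := fun a _ => a = x) rfl g) c).symm
  · rw [ev_ev_comul_of_ne h]
    exact (LinearMap.congr_fun (ev_comp_sel_of_not (T := fun a _ => a = x) (Ne.symm h) g) c).symm

lemma counitAt_lTensor_comul (x : E) (c : CatCoalg k E) :
    TensorProduct.rid k _ ((counitAt k x).lTensor _ (Coalgebra.comul (R := k) c)) =
      sel k (fun _ b => b = x) c := by
  refine ext_ev fun a b g => ?_
  have h1 : ∀ s : CatCoalg k E ⊗[k] CatCoalg k E,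
      ev g (TensorProduct.rid k _ ((counitAt k x).lTensor _ s)) =
      TensorProduct.lid k k (TensorProduct.map (ev g) (ev (𝟙 x)) s) := by
    intro s
    induction s with
    | zero => simp
    | add s t hs ht => simp only [map_add, hs, ht]
    | tmul f f' => simp [counitAt_eq_ev, mul_comm]
  rw [h1]
  by_cases h : b = x
  · subst h
    rw [ev_ev_comul, Category.comp_id]
    exact (LinearMap.congr_fun (ev_comp_sel (T := fun _ c => c = b) rfl g) c).symm
  · rw [ev_ev_comul_of_ne h]
    exact (LinearMap.congr_fun (ev_comp_sel_of_not (T := fun _ b => b = x) h g) c).symm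

lemma comul_incl (x y : E) (φ : Module.Dual k (x ⟶ y)) :
    Coalgebra.comul (R := k) (incl k x y φ) = ∑ z ∈ interval k x y,
      TensorProduct.map (incl k x z) (incl k z y) (comulComp k x z y φ) :=
  comulMap_incl x y φ

/-- The counit is the locally finite sum of the functionals `ε_x`. -/
lemma exists_counit_eq_sum (c : CatCoalg k E) : ∃ S : Finset E, ∀ S', S ⊆ S' →
    Coalgebra.counit (R := k) c = ∑ x ∈ S', counitAt k x c := by
  classical
  have h0 : ∀ x y (φ : Module.Dual k (x ⟶ y)) (S : Finset E), x ∈ S →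
      counitMap k (incl k x y φ) = ∑ z ∈ S, counitAt k z (incl k x y φ) := by
    intro x y φ S hx
    rw [Finset.sum_eq_single_of_mem x hx]
    · by_cases hxy : x = y
      · subst hxy
        rw [counitMap_incl_self, counitAt_eq_ev, ev_incl_self]
      · rw [counitMap_incl_of_ne hxy, counitAt_eq_ev, ev_incl_of_ne]
        exact fun e => hxy e.2.symm
    · intro z _ hz
      rw [counitAt_eq_ev, ev_incl_of_ne]
      exact fun e => hz e.1.symm
  change ∃ S : Finset E, ∀ S', S ⊆ S' → counitMap k c = _
  induction c using DirectSum.induction_on with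
  | zero => exact ⟨∅, fun S _ => by
      rw [show (0 : ⨁ p : E × E, Module.Dual k (p.1 ⟶ p.2)) = (0 : CatCoalg k E) from rfl]
      simp⟩
  | of p φ =>
    refine ⟨{p.1}, fun S hS => ?_⟩
    exact h0 p.1 p.2 φ S (hS (Finset.mem_singleton_self _))
  | add c d hc hd =>
    obtain ⟨S, hS⟩ := hc
    obtain ⟨T, hT⟩ := hd
    refine ⟨S ∪ T, fun S' h => ?_⟩
    have e1 := hS S' (Finset.union_subset_left h)
    have e2 := hT S' (Finset.union_subset_right h)
    calc counitMap k (E := E) (c + d : CatCoalg k E)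
        = counitMap k (E := E) c + counitMap k (E := E) d := map_add _ _ _
      _ = ∑ x ∈ S', (counitAt k x c + counitAt k x d) := by
        rw [e1, e2, Finset.sum_add_distrib]
      _ = _ := Finset.sum_congr rfl fun x _ => (map_add (counitAt k x) c d).symm

end Comul

end CatCoalg

/-! ### A contramodule as the product of its components. -/

namespace LeftContra

section General

variable {k : Type u} [Field k] {C : Type v} [AddCommGroup C] [Module k C] [Coalgebra k C]

lemma act_apply (P : LeftContra.{u, v, t} k C) (φ : Module.Dual k C) (p : P.carrier) :
    P.act φ p = P.contraact (φ.smulRight p) := rfl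

/-- Contraassociativity for `v ↦ φ(v) F`. With the chosen identification φ is applied to the second
tensor factor, which is why components of values of the contraaction are indexed by targets of
morphisms. -/
lemma act_contraact (P : LeftContra.{u, v, t} k C) (φ : Module.Dual k C) (F : C →ₗ[k] P.carrier) :
    P.act φ (P.contraact F) = P.contraact (F ∘ₗ (TensorProduct.rid k C).toLinearMap ∘ₗ
      φ.lTensor C ∘ₗ Coalgebra.comul (R := k)) := by
  have h := P.contraassoc (φ.smulRight F)
  have h1 : P.contraact ∘ₗ φ.smulRight F = φ.smulRight (P.contraact F) := by
    ext; simp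
  rw [h1] at h
  rw [act_apply, h]
  congr 1
  simp only [← LinearMap.comp_assoc]
  congr 1
  ext; simp

lemma act_comm {P Q : LeftContra.{u, v, t} k C} (f : LeftContra.Hom P Q) (φ : Module.Dual k C)
    (p : P.carrier) : f.toLinearMap (P.act φ p) = Q.act φ (f.toLinearMap p) := by
  rw [act_apply, f.comm, act_apply]
  congr 1
  ext; simp

end General

open CatCoalg

variable {k : Type u} [Field k] {E : Type v} [Category.{w} E] [Preadditive E] [Linear k E]
  [LocallyFiniteCat k E] (P : LeftContra.{u, max u v w, t} k (CatCoalg k E))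

lemma act_counitAt_contraact (y : E) (F : CatCoalg k E →ₗ[k] P.carrier) :
    P.act (counitAt k y) (P.contraact F) = P.contraact (F ∘ₗ sel k fun _ b => b = y) := by
  rw [act_contraact]
  congr 2
  exact LinearMap.ext fun c => counitAt_lTensor_comul y c

lemma act_counitAt_idem (y : E) (p : P.carrier) :
    P.act (counitAt k y) (P.act (counitAt k y) p) = P.act (counitAt k y) p := by
  conv_lhs => rw [act_apply P _ p, act_counitAt_contraact]
  rw [act_apply]
  congr 1
  refine LinearMap.ext fun c => ?_
  simp only [LinearMap.comp_apply, LinearMap.smulRight_apply]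
  rw [← LinearMap.comp_apply, counitAt_comp_sel]

lemma act_counitAt_of_mem {y : E} {p : P.carrier} (hp : p ∈ P.component y) :
    P.act (counitAt k y) p = p := by
  obtain ⟨q, rfl⟩ := hp
  exact act_counitAt_idem P y q

/-- The value of the contraaction on a family of maps `Hom(a, b)^* → P` only depends on the
components of these maps in `P^a`. -/
lemma contraact_eq_row (F : CatCoalg k E →ₗ[k] P.carrier) :
    P.contraact F =
      P.contraact (desc k fun a b => P.act (counitAt k a) ∘ₗ F ∘ₗ incl k a b) := by
  classical
  -- Contraassociativity for this `G` compares the two sides: applying the contraaction inside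
  -- yields the row-projected family, while the comultiplication with ε_a contracted on the left
  -- gives back `F`.
  set G : CatCoalg k E →ₗ[k] CatCoalg k E →ₗ[k] P.carrier :=
    desc k fun a b => LinearMap.smulRightₗ (counitAt k a) ∘ₗ F ∘ₗ incl k a b with hG
  have hGi : ∀ a b φ, G (incl k a b φ) = (counitAt k a).smulRight (F (incl k a b φ)) := by
    intro a b φ
    rw [hG, desc_incl]
    rfl
  have h := P.contraassoc G
  have h1 : P.contraact ∘ₗ G = desc k fun a b => P.act (counitAt k a) ∘ₗ F ∘ₗ incl k a b := by
    refine hom_ext fun a b φ => ?_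
    rw [LinearMap.comp_apply, hGi, desc_incl]
    rfl
  have h2 : TensorProduct.lift G.flip ∘ₗ Coalgebra.comul (R := k) = F := by
    refine hom_ext fun a b φ => ?_
    have h3 : TensorProduct.lift G.flip (Coalgebra.comul (R := k) (incl k a b φ)) =
        F (TensorProduct.lid k _ ((counitAt k a).rTensor _
          (Coalgebra.comul (R := k) (incl k a b φ)))) := by
      rw [comul_incl]
      simp only [map_sum]
      refine Finset.sum_congr rfl fun z _ => ?_
      generalize comulComp k a z b φ = s
      induction s with
      | zero => simp
      | add s t hs ht => simp only [map_add, hs, ht]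
      | tmul f g =>
        simp only [TensorProduct.map_tmul, TensorProduct.lift.tmul, LinearMap.flip_apply, hGi,
          LinearMap.smulRight_apply, LinearMap.rTensor_tmul, TensorProduct.lid_tmul, map_smul]
        by_cases hz : z = a
        · subst hz
          rfl
        · rw [counitAt_eq_ev, counitAt_eq_ev, ev_incl_of_ne, ev_incl_of_ne]
          · exact fun e => hz e.2
          · exact fun e => hz e.1.symm
    rw [LinearMap.comp_apply, h3, counitAt_rTensor_comul, sel_incl (T := fun c _ => c = a) rfl]
  rw [h1, h2] at h
  exact h.symm

/-- By contraunitality `p` is the contraaction of the counit times `p`, and `contraact_eq_row` sees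
only the components of `p` there. -/
lemma eq_zero_of_act_counitAt {p : P.carrier} (h : ∀ x, P.act (counitAt k x) p = 0) : p = 0 := by
  rw [← P.contraunit p, contraact_eq_row]
  have : (desc k fun a b => P.act (counitAt k a) ∘ₗ
      (Coalgebra.counit (R := k) (A := CatCoalg k E)).smulRight p ∘ₗ incl k a b) = 0 := by
    refine hom_ext fun a b φ => ?_
    rw [desc_incl]
    simp [h]
  rw [this, map_zero]

/-- A contramodule over the coalgebra of a category surjects onto the product of its components. -/
lemma exists_act_counitAt_eq (p : ∀ y, P.component y) :
    ∃ q : P.carrier, ∀ y, P.act (counitAt k y) q = p y := by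
  classical
  -- The counit is supported on the diagonal blocks, so this family places `p a` on `Hom(a, a)^*`.
  -- An arbitrary, infinite collection of components is allowed because the coalgebra is a direct
  -- sum.
  refine ⟨P.contraact (desc k fun a b => (Coalgebra.counit (R := k) ∘ₗ incl k a b).smulRight
    (p a : P.carrier)), fun y => ?_⟩
  rw [act_counitAt_contraact, ← act_counitAt_of_mem P (p y).2, act_apply]
  congr 1
  refine hom_ext fun a b φ => ?_
  have hc : ∀ c, Coalgebra.counit (R := k) (A := CatCoalg k E) c = counitMap k c := fun _ => rfl
  by_cases hb : b = y
  · rw [LinearMap.comp_apply, sel_incl (T := fun _ c => c = y) hb, desc_incl]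
    subst hb
    simp only [LinearMap.smulRight_apply, LinearMap.comp_apply, hc]
    by_cases hab : a = b
    · subst hab
      rw [counitMap_incl_self, counitAt_eq_ev, ev_incl_self]
    · rw [counitMap_incl_of_ne hab, counitAt_eq_ev, ev_incl_of_ne, zero_smul, zero_smul]
      exact fun e => hab e.1
  · rw [LinearMap.comp_apply, sel_incl_of_not (T := fun _ c => c = y) hb, map_zero,
      LinearMap.smulRight_apply, counitAt_eq_ev, ev_incl_of_ne, zero_smul]
    exact fun e => hb e.2

end LeftContra

/-! ### Linear algebra over a field: factorizations and sections. -/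

lemma LinearMap.exists_comp_eq_of_ker_le_ker {k V W Z : Type*} [Field k] [AddCommGroup V]
    [Module k V] [AddCommGroup W] [Module k W] [AddCommGroup Z] [Module k Z] (f : V →ₗ[k] Z)
    (g : V →ₗ[k] W) (h : LinearMap.ker g ≤ LinearMap.ker f) : ∃ H : W →ₗ[k] Z, H ∘ₗ g = f := by
  -- On the image of `g` the map is `f` after any section, the choice being immaterial by the kernel
  -- inclusion; it is then extended to all of `W`.
  obtain ⟨s, hs⟩ := LinearMap.exists_rightInverse_of_surjective g.rangeRestrict g.range_rangeRestrict
  obtain ⟨H, hH⟩ := LinearMap.exists_extend (f ∘ₗ s)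
  refine ⟨H, LinearMap.ext fun v => ?_⟩
  have h1 := LinearMap.congr_fun hH (g.rangeRestrict v)
  have h2 : g (s (g.rangeRestrict v)) = g v :=
    congrArg Subtype.val (LinearMap.congr_fun hs (g.rangeRestrict v))
  have h3 : s (g.rangeRestrict v) - v ∈ LinearMap.ker f :=
    h (by rw [LinearMap.mem_ker, map_sub, h2, sub_self])
  rw [LinearMap.mem_ker, map_sub, sub_eq_zero] at h3
  exact h1.trans h3

/-- A linear section, over a subspace of the image, of the restriction of a linear map. -/
lemma LinearMap.exists_section_of_le_map {k V W : Type*} [Field k] [AddCommGroup V]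
    [Module k V] [AddCommGroup W] [Module k W] (f : V →ₗ[k] W) (A : Submodule k V)
    (B : Submodule k W) (h : B ≤ A.map f) :
    ∃ s : W →ₗ[k] V, (∀ w, s w ∈ A) ∧ ∀ w ∈ B, f (s w) = w := by
  obtain ⟨r, hr⟩ := LinearMap.exists_rightInverse_of_surjective (f ∘ₗ A.subtype).rangeRestrict
    (LinearMap.range_rangeRestrict _)
  obtain ⟨e, he⟩ := LinearMap.exists_extend r
  refine ⟨A.subtype ∘ₗ e, fun w => (e w).2, fun w hw => ?_⟩
  have hw' : w ∈ LinearMap.range (f ∘ₗ A.subtype) := by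
    obtain ⟨a, ha, rfl⟩ := h hw
    exact ⟨⟨a, ha⟩, rfl⟩
  have h1 : e w = r ⟨w, hw'⟩ := LinearMap.congr_fun he ⟨w, hw'⟩
  have h2 := congrArg Subtype.val (LinearMap.congr_fun hr ⟨w, hw'⟩)
  rw [LinearMap.comp_apply, h1]
  exact h2

/-! ### Well-foundedness of the preorder on objects below a fixed object. -/

section Order

variable {E : Type v} [Category.{w} E] [Preadditive E]

/-- `⪯` is not reflexive at zero objects. A chain out of `x` begins with a nonzero morphism, which
forces `𝟙 x ≠ 0`. -/
lemma MorphLE.self_left {x y : E} (h : MorphLE x y) : MorphLE x x := by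
  have : ∃ z, ∃ f : x ⟶ z, f ≠ 0 := by
    induction h with
    | single h => exact ⟨_, h⟩
    | tail _ _ ih => exact ih
  obtain ⟨z, f, hf⟩ := this
  refine .single ⟨𝟙 x, fun h0 => hf ?_⟩
  rw [← Category.id_comp f, h0, Limits.zero_comp]

/-- Ascending chains below an object `b` of a locally finite category are finite. -/
lemma wellFounded_morphLT_below (k : Type u) [Field k] [Linear k E] [LocallyFiniteCat k E] (b : E) :
    WellFounded fun z' z : E => MorphLT z z' ∧ MorphLE z' b := by
  refine Subrelation.wf (r := InvImage (· < ·) fun z => (CatCoalg.interval k z b).card) ?_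
    (InvImage.wf _ wellFounded_lt)
  rintro z' z ⟨h, hb⟩
  refine Finset.card_lt_card ⟨fun a ha => ?_, fun hs => ?_⟩
  · rw [CatCoalg.mem_interval] at ha ⊢
    exact ⟨h.1.trans ha.1, ha.2⟩
  -- The object `z` itself witnesses strictness: it lies in its own interval up to `b` but not in
  -- the one starting at `z'`.
  · have : z ∈ CatCoalg.interval k z b := CatCoalg.mem_interval.2 ⟨h.1.self_left, h.1.trans hb⟩
    exact h.2 (CatCoalg.mem_interval.1 (hs this)).1

end Order

/-! ### Tails of the contraaction and their stable values. -/

namespace LeftContra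

open CatCoalg

variable {k : Type u} [Field k] {E : Type v} [Category.{w} E] [Preadditive E] [Linear k E]
  [LocallyFiniteCat k E] (P : LeftContra.{u, max u v w, t} k (CatCoalg k E))

/-- The subspace of the component `P^y` formed by the values of the contraaction on families of
maps `Hom(z, y)^* → P` with `z` outside of a finite set `S`. -/
def tail (y : E) (S : Finset E) : Submodule k P.carrier :=
  LinearMap.range (P.contraact ∘ₗ
    LinearMap.lcomp k P.carrier (sel k fun a b => a ∉ S ∧ b = y))

variable {P} in
lemma mem_tail {y : E} {S : Finset E} {p : P.carrier} :
    p ∈ P.tail y S ↔ ∃ F, P.contraact (F ∘ₗ sel k fun a b => a ∉ S ∧ b = y) = p := Iff.rfl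

lemma tail_anti (y : E) {S T : Finset E} (h : S ⊆ T) : P.tail y T ≤ P.tail y S := by
  rintro _ ⟨F, rfl⟩
  refine ⟨F ∘ₗ sel k fun a b => a ∉ T ∧ b = y, ?_⟩
  simp only [LinearMap.comp_apply, LinearMap.lcomp_apply']
  rw [LinearMap.comp_assoc, sel_comp_sel]
  congr 3
  ext a b
  exact ⟨fun e => e.1, fun e => ⟨e, fun ha => e.1 (h ha), e.2⟩⟩

lemma tail_le_component (y : E) (S : Finset E) : P.tail y S ≤ P.component y := by
  rintro _ ⟨F, rfl⟩
  refine ⟨P.contraact (F ∘ₗ sel k fun a b => a ∉ S ∧ b = y), ?_⟩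
  simp only [LinearMap.comp_apply, LinearMap.lcomp_apply']
  rw [act_counitAt_contraact, LinearMap.comp_assoc, sel_comp_sel]
  congr 3
  ext a b
  exact ⟨fun e => e.1, fun e => ⟨e, e.2⟩⟩

/-- The intersection of all the subspaces `P.tail y S`. -/
def stableTail (y : E) : Submodule k P.carrier := ⨅ S, P.tail y S

variable {P}

/-- The tails form a directed decreasing family of subspaces of a finite-dimensional component; one
of minimal dimension equals all later ones, hence the intersection. -/
lemma exists_tail_eq_stableTail {y : E} (hP : FiniteDimensional k (P.component y)) :
    ∃ S, ∀ T, S ⊆ T → P.tail y T = P.stableTail y := by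
  classical
  have hfin : ∀ S, FiniteDimensional k (P.tail y S) := fun S =>
    Submodule.finiteDimensional_of_le (P.tail_le_component y S)
  obtain ⟨S, -, hS⟩ := exists_minimalFor_of_wellFoundedLT (fun _ : Finset E => True)
    (fun S => Module.finrank k (P.tail y S)) ⟨∅, trivial⟩
  have h1 : ∀ T, S ⊆ T → P.tail y T = P.tail y S := fun T hT =>
    Submodule.eq_of_le_of_finrank_le (P.tail_anti y hT)
      (hS trivial (Submodule.finrank_mono (P.tail_anti y hT)))
  have h2 : P.tail y S = P.stableTail y := by
    refine le_antisymm (le_iInf fun T => ?_) (iInf_le _ _)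
    rw [← h1 (S ∪ T) Finset.subset_union_left]
    exact P.tail_anti y Finset.subset_union_right
  exact ⟨S, fun T hT => (h1 T hT).trans h2⟩

variable (P)

/-- The linear maps from the coalgebra to a contramodule that vanish outside of the components
`Hom(x, y)^*` with `x ∈ X`, and take values in the subspaces `P.stableTail x`. -/
def frontierMaps (X : Set E) (y : E) : Submodule k (CatCoalg k E →ₗ[k] P.carrier) where
  carrier := {F | (∀ a b φ, ¬ (a ∈ X ∧ b = y) → F (incl k a b φ) = 0) ∧
    ∀ a b φ, F (incl k a b φ) ∈ P.stableTail a}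
  zero_mem' := ⟨fun _ _ _ _ => rfl, fun _ _ _ => zero_mem _⟩
  add_mem' h h' := ⟨fun a b φ e => by rw [LinearMap.add_apply, h.1 a b φ e, h'.1 a b φ e, add_zero],
    fun a b φ => add_mem (h.2 a b φ) (h'.2 a b φ)⟩
  smul_mem' r _ h := ⟨fun a b φ e => by rw [LinearMap.smul_apply, h.1 a b φ e, smul_zero],
    fun a b φ => Submodule.smul_mem _ r (h.2 a b φ)⟩

variable {P}

/-- The step to be iterated: an element of the stable tail at `y` comes from stable tails at the
frontier objects. A family supported far from `y` factors through the part of the comultiplication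
that passes through `X`, and contraassociativity evaluates it in two stages. -/
lemma stableTail_le_map_frontierMaps (hP : ∀ x, FiniteDimensional k (P.component x)) {y : E}
    {X : Set E} (hXf : X.Finite)
    (hX : ∀ z : E, MorphLT z y → ∀ f : z ⟶ y,
      ∃ (n : ℕ) (x : Fin n → E) (g : ∀ i, z ⟶ x i) (h : ∀ i, x i ⟶ y),
        (∀ i, x i ∈ X) ∧ f = ∑ i, g i ≫ h i) :
    P.stableTail y ≤ (P.frontierMaps X y).map P.contraact := by
  classical
  intro p hp
  choose S hS using fun x => exists_tail_eq_stableTail (hP x)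
  -- Removing the interval from `y` to `y` leaves only sources `z ≺ y` among those with a nonzero
  -- morphism to `y`; removing the sets `S x` puts the inner values into the stable tails at all `x
  -- ∈ X`.
  set T : Finset E := interval k y y ∪ hXf.toFinset.biUnion S with hT
  have hpT : p ∈ P.tail y T := (iInf_le (fun S => P.tail y S) T) hp
  obtain ⟨F, rfl⟩ := mem_tail.1 hpT
  set F' := F ∘ₗ sel k fun a b => a ∉ T ∧ b = y with hF'
  -- the part of the comultiplication with middle index in `X`
  set D : CatCoalg k E →ₗ[k] CatCoalg k E ⊗[k] CatCoalg k E := ∑ x ∈ hXf.toFinset,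
    TensorProduct.map (sel k fun a b => a ∉ T ∧ b = x) (sel k fun a b => a = x ∧ b = y) ∘ₗ
      Coalgebra.comul (R := k) with hD
  have hev : ∀ (z x : E) (g : z ⟶ x) (h : x ⟶ y), z ∉ T → x ∈ X → ∀ c,
      TensorProduct.lid k k (TensorProduct.map (ev g) (ev h) (D c)) = ev (g ≫ h) c := by
    intro z x g h hz hx c
    rw [hD, LinearMap.sum_apply, map_sum, map_sum,
      Finset.sum_eq_single_of_mem x (hXf.mem_toFinset.2 hx)]
    · rw [LinearMap.comp_apply, ← LinearMap.comp_apply, ← TensorProduct.map_comp,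
        ev_comp_sel (T := fun a b => a ∉ T ∧ b = x) ⟨hz, rfl⟩,
        ev_comp_sel (T := fun a b => a = x ∧ b = y) ⟨rfl, rfl⟩, ev_ev_comul]
    · intro x' _ hne
      rw [LinearMap.comp_apply, ← LinearMap.comp_apply, ← TensorProduct.map_comp,
        ev_comp_sel_of_not (T := fun a b => a ∉ T ∧ b = x') (fun e => hne e.2.symm)]
      simp
  -- Dual form of the frontier condition: if all evaluations of `c` at composites through `X`
  -- vanish, so do its evaluations at all morphisms `z ⟶ y` with `z ∉ T`.
  have hker : LinearMap.ker D ≤ LinearMap.ker F' := by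
    intro c hc
    rw [LinearMap.mem_ker] at hc ⊢
    suffices h : sel k (fun a b => a ∉ T ∧ b = y) c = 0 by
      rw [hF', LinearMap.comp_apply, h, map_zero]
    refine eq_zero_of_ev fun z b f => ?_
    rw [← LinearMap.comp_apply]
    by_cases hz : z ∉ T ∧ b = y
    · obtain ⟨hz, rfl⟩ := hz
      rw [ev_comp_sel (T := fun a b' => a ∉ T ∧ b' = b) ⟨hz, rfl⟩]
      by_cases hf : f = 0
      · simp [hf]
      have hzb : MorphLT z b := by
        refine ⟨.single ⟨f, hf⟩, fun hbz => hz ?_⟩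
        exact Finset.mem_union_left _ (mem_interval.2 ⟨hbz, .single ⟨f, hf⟩⟩)
      obtain ⟨n, x, g, h, hx, rfl⟩ := hX z hzb f
      rw [ev_sum, LinearMap.sum_apply]
      refine Finset.sum_eq_zero fun i _ => ?_
      rw [← hev z (x i) (g i) (h i) hz (hx i), hc, map_zero, map_zero]
    · rw [ev_comp_sel_of_not (T := fun a b' => a ∉ T ∧ b' = y) hz, LinearMap.zero_apply]
  obtain ⟨H, hH⟩ := LinearMap.exists_comp_eq_of_ker_le_ker F' D hker
  -- The factorization of `F'` through `D`, curried so that the contraaction is applied first in the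
  -- variable from `Hom(z, x)^*` and then in the one from `Hom(x, y)^*`.
  set G : CatCoalg k E →ₗ[k] CatCoalg k E →ₗ[k] P.carrier := ∑ x ∈ hXf.toFinset,
    LinearMap.flip (TensorProduct.curry (H ∘ₗ
      TensorProduct.map (sel k fun a b => a ∉ T ∧ b = x) (sel k fun a b => a = x ∧ b = y))) with hG
  have hGF : TensorProduct.lift G.flip ∘ₗ Coalgebra.comul (R := k) = F' := by
    have hD' : D = (∑ x ∈ hXf.toFinset,
        TensorProduct.map (sel k fun a b => a ∉ T ∧ b = x) (sel k fun a b => a = x ∧ b = y)) ∘ₗ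
        Coalgebra.comul (R := k) := LinearMap.ext fun c => by
      simp only [hD, LinearMap.sum_apply, LinearMap.comp_apply]
    rw [← hH, hD', ← LinearMap.comp_assoc]
    congr 1
    ext u v
    simp [hG]
  have hGv : ∀ v, G v = ∑ x ∈ hXf.toFinset, (H ∘ₗ (TensorProduct.mk k _ _).flip
      (sel k (fun a b => a = x ∧ b = y) v)) ∘ₗ sel k fun a b => a ∉ T ∧ b = x := by
    intro v
    refine LinearMap.ext fun u => ?_
    simp [hG, LinearMap.sum_apply]
  refine ⟨P.contraact ∘ₗ G, ⟨fun a b φ hab => ?_, fun a b φ => ?_⟩, ?_⟩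
  · rw [LinearMap.comp_apply, hGv, Finset.sum_eq_zero, map_zero]
    intro x hx
    rw [sel_incl_of_not]
    · simp
    · rintro ⟨rfl, rfl⟩
      exact hab ⟨hXf.mem_toFinset.1 hx, rfl⟩
  · rw [LinearMap.comp_apply, hGv, map_sum]
    refine Submodule.sum_mem _ fun x hx => ?_
    by_cases hax : a = x
    · subst hax
      -- Since `T` contains `S a`, the tail of `a` beyond `T` already equals the stable one, so a
      -- value of the contraaction supported off `T` suffices.
      rw [← hS a T]
      · exact mem_tail.2 ⟨_, rfl⟩
      · exact (Finset.subset_biUnion_of_mem S hx).trans Finset.subset_union_right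
    · rw [sel_incl_of_not (T := fun a b => a = x ∧ b = y) (fun e => hax e.1)]
      simp
  · rw [P.contraassoc, hGF]

end LeftContra

/-! ### Vanishing of the stable tails. -/

namespace LeftContra

open CatCoalg

variable {k : Type u} [Field k] {E : Type v} [Category.{w} E] [Preadditive E] [Linear k E]
  [LocallyFiniteCat k E] {P : LeftContra.{u, max u v w, t} k (CatCoalg k E)}

/-- The map `Hom(z, b)^* → P` obtained from `σ w : P → Hom(C, P)` and `r : Hom(w, b)^* → P` by
means of the comultiplication `Hom(z, b)^* → Hom(z, w)^* ⊗ Hom(w, b)^*`. -/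
def convolve (z w b : E) (s : P.carrier →ₗ[k] CatCoalg k E →ₗ[k] P.carrier)
    (r : Module.Dual k (w ⟶ b) →ₗ[k] P.carrier) : Module.Dual k (z ⟶ b) →ₗ[k] P.carrier :=
  TensorProduct.lift ((s ∘ₗ r).flip ∘ₗ incl k z w) ∘ₗ comulComp k z w b

lemma convolve_mem {z w b : E} {s : P.carrier →ₗ[k] CatCoalg k E →ₗ[k] P.carrier}
    {r : Module.Dual k (w ⟶ b) →ₗ[k] P.carrier} (A : Submodule k P.carrier)
    (h : ∀ φ ψ, s (r φ) (incl k z w ψ) ∈ A) (φ : Module.Dual k (z ⟶ b)) :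
    convolve z w b s r φ ∈ A := by
  rw [convolve, LinearMap.comp_apply]
  generalize comulComp k z w b φ = t
  induction t with
  | zero => simp
  | add t t' ht ht' => rw [map_add]; exact add_mem ht ht'
  | tmul f g => exact h g f

open Classical in
/-- The solution `q` of the recursive equation `q = F + ∑_w convolve (σ w) q`. -/
def recSol (F : CatCoalg k E →ₗ[k] P.carrier)
    (σ : E → P.carrier →ₗ[k] CatCoalg k E →ₗ[k] P.carrier) (b : E) :
    ∀ z : E, Module.Dual k (z ⟶ b) →ₗ[k] P.carrier :=
  -- The recursion moves `z` upwards towards the fixed target `b`. Terms with `z ⊀ w` are dropped;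
  -- in the application they vanish, because `σ w` is supported on sources strictly below `w`.
  (wellFounded_morphLT_below k b).fix fun z r => F ∘ₗ incl k z b + ∑ w ∈ interval k z b,
    if h : MorphLT z w ∧ MorphLE w b then convolve z w b (σ w) (r w h) else 0

open Classical in
lemma recSol_eq (F : CatCoalg k E →ₗ[k] P.carrier)
    (σ : E → P.carrier →ₗ[k] CatCoalg k E →ₗ[k] P.carrier) (b z : E) :
    recSol F σ b z = F ∘ₗ incl k z b + ∑ w ∈ interval k z b,
      if MorphLT z w ∧ MorphLE w b then convolve z w b (σ w) (recSol F σ b w) else 0 := by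
  rw [recSol, WellFounded.fix_eq]
  congr 1

/-- A linear choice of preimages `σ` turns the one-step result into a recursion. Its solution `q`
satisfies both `q = π ∘ G` and `q = F +` (the map obtained from `G` by comultiplication);
contraassociativity identifies the contraactions of the two `G`-terms, leaving `π(F) = 0`. -/
lemma stableTail_eq_bot (hP : ∀ x, FiniteDimensional k (P.component x))
    (hE : ∀ y : E, ∃ X : Set E, X.Finite ∧ (∀ x ∈ X, MorphLT x y) ∧
    ∀ z : E, MorphLT z y → ∀ f : z ⟶ y,
      ∃ (n : ℕ) (x : Fin n → E) (g : ∀ i, z ⟶ x i) (h : ∀ i, x i ⟶ y),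
        (∀ i, x i ∈ X) ∧ f = ∑ i, g i ≫ h i) (y : E) :
    P.stableTail y = ⊥ := by
  classical
  rw [eq_bot_iff]
  intro p hp
  choose X hXf hXlt hX using hE
  choose σ hσ hσ' using fun w => LinearMap.exists_section_of_le_map P.contraact
    (P.frontierMaps (X w) w) (P.stableTail w) (stableTail_le_map_frontierMaps hP (hXf w) (hX w))
  -- Chosen so that its contraaction is the `y`-component of `p`, which is `p` itself.
  set F : CatCoalg k E →ₗ[k] P.carrier := (counitAt k y).smulRight p with hF
  have hFmem : ∀ z b φ, F (incl k z b φ) ∈ P.stableTail z := by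
    intro z b φ
    rw [hF, LinearMap.smulRight_apply]
    by_cases h : z = y
    · subst h
      exact Submodule.smul_mem _ _ hp
    · rw [counitAt_eq_ev, ev_incl_of_ne _ (fun e => h e.1), zero_smul]
      exact zero_mem _
  -- The sections `σ w` invert the contraaction only on stable tails, so the recursion must not
  -- leave them.
  have hqmem : ∀ b z φ, recSol F σ b z φ ∈ P.stableTail z := by
    intro b z φ
    rw [recSol_eq, LinearMap.add_apply, LinearMap.sum_apply]
    refine add_mem (hFmem _ _ _) (Submodule.sum_mem _ fun w _ => ?_)
    split_ifs
    · exact convolve_mem _ (fun φ ψ => (hσ w _).2 _ _ _) _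
    · exact zero_mem _
  set q : CatCoalg k E →ₗ[k] P.carrier := desc k fun z b => recSol F σ b z with hq
  set G : CatCoalg k E →ₗ[k] CatCoalg k E →ₗ[k] P.carrier :=
    desc k fun w b => σ w ∘ₗ recSol F σ b w with hG
  have h1 : P.contraact ∘ₗ G = q := by
    refine hom_ext fun w b φ => ?_
    rw [LinearMap.comp_apply, hG, hq, desc_incl, desc_incl, LinearMap.comp_apply,
      hσ' w _ (hqmem b w φ)]
  have h2 : F + TensorProduct.lift G.flip ∘ₗ Coalgebra.comul (R := k) = q := by
    refine hom_ext fun z b φ => ?_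
    rw [hq, desc_incl, recSol_eq, LinearMap.add_apply, LinearMap.add_apply, LinearMap.sum_apply,
      LinearMap.comp_apply, LinearMap.comp_apply, comul_incl, map_sum]
    congr 1
    refine Finset.sum_congr rfl fun w hw => ?_
    have h3 : TensorProduct.lift G.flip (TensorProduct.map (incl k z w) (incl k w b)
        (comulComp k z w b φ)) = convolve z w b (σ w) (recSol F σ b w) φ := by
      rw [convolve, LinearMap.comp_apply, ← LinearMap.comp_apply]
      congr 1
      ext f g
      simp [hG]
    rw [h3]
    by_cases hzw : MorphLT z w
    · rw [if_pos ⟨hzw, (mem_interval.1 hw).2⟩]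
    · rw [if_neg fun e => hzw e.1, LinearMap.zero_apply, ← Submodule.mem_bot k]
      refine convolve_mem _ (fun φ ψ => ?_) φ
      rw [Submodule.mem_bot]
      exact (hσ w _).1 _ _ _ fun e => hzw (hXlt w z e.1)
  -- This reads π(q) = π(q − F).
  have h4 := P.contraassoc G
  rw [h1, ← h2, map_add, add_eq_right] at h4
  have h5 : P.act (counitAt k y) p = p :=
    act_counitAt_of_mem P (P.tail_le_component y ∅ ((iInf_le (fun S => P.tail y S) ∅) hp))
  rw [Submodule.mem_bot, ← h5, act_apply]
  exact h4

/-- Under left strict local finiteness, the `y`-component of the contraaction of a locally finite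
contramodule only depends on finitely many of the components `Hom(z, y)^* → P`. -/
theorem exists_finset_contraact_eq_zero {E : Type v} [Category.{w} E] [Preadditive E] [Linear k E]
    [LeftStrictlyLocallyFiniteCat k E] {P : LeftContra.{u, max u v w, t} k (CatCoalg k E)}
    (hP : IsLocallyFiniteLeftContra.{u, v, w, t} k E P) (y : E) :
    ∃ S : Finset E, ∀ F : CatCoalg k E →ₗ[k] P.carrier,
      P.contraact (F ∘ₗ sel k fun a b => a ∉ S ∧ b = y) = 0 := by
  obtain ⟨S, hS⟩ := exists_tail_eq_stableTail (hP y)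
  refine ⟨S, fun F => ?_⟩
  have h : P.contraact (F ∘ₗ sel k fun a b => a ∉ S ∧ b = y) ∈ P.tail y S := mem_tail.2 ⟨F, rfl⟩
  rw [hS S (Finset.Subset.refl S),
    stableTail_eq_bot hP (LeftStrictlyLocallyFiniteCat.exists_frontier (k := k)) y] at h
  exact (Submodule.mem_bot k).1 h

end LeftContra

/-! ### Detecting elements of a tensor product by linear maps. -/

section Pairing

variable {k V : Type*} [Field k] [AddCommGroup V] [Module k V] (N : Submodule k (Module.Dual k V))
  (D : Type*) [AddCommGroup D] [Module k D]

/-- The pairing between `N ⊗ D` and `Hom(D, V)` for a subspace `N` of the dual of `V`. -/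
def dualPairing : N ⊗[k] D →ₗ[k] Module.Dual k (D →ₗ[k] V) :=
  TensorProduct.lift (LinearMap.mk₂ k (fun n d => (n : Module.Dual k V) ∘ₗ LinearMap.applyₗ d)
    (fun _ _ _ => rfl) (fun _ _ _ => rfl) (fun _ _ _ => by ext; simp)
    (fun _ _ _ => by ext; simp))

variable {N D}

@[simp]
lemma dualPairing_tmul (n : N) (d : D) (F : D →ₗ[k] V) :
    dualPairing N D (n ⊗ₜ d) F = (n : Module.Dual k V) (F d) := rfl

/-- A basis of `D` turns an element of `N ⊗ D` into a finitely supported family of functionals, and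
pairing with rank-one maps reads off each of them. This makes the coaction unique, and lets comodule
axioms be checked by pairing. -/
lemma dualPairing_injective : Function.Injective (dualPairing N D) := by
  classical
  intro s t hst
  let b := Module.Basis.ofVectorSpace k D
  have h : ∀ (s : N ⊗[k] D) i (p : V), dualPairing N D s ((b.coord i).smulRight p) =
      ((TensorProduct.equivFinsuppOfBasisRight b s i : N) : Module.Dual k V) p := by
    intro s i p
    induction s with
    | zero => simp
    | add s t hs ht => simp only [map_add, LinearMap.add_apply, hs, ht, Finsupp.add_apply,
        Submodule.coe_add]
    | tmul n d => simp
  refine (TensorProduct.equivFinsuppOfBasisRight b).injective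
    (Finsupp.ext fun i => Subtype.ext (LinearMap.ext fun p => ?_))
  rw [← h, ← h, hst]

lemma dualPairing_lTensor {D' : Type*} [AddCommGroup D'] [Module k D'] (f : D →ₗ[k] D')
    (s : N ⊗[k] D) (F : D' →ₗ[k] V) :
    dualPairing N D' (f.lTensor N s) F = dualPairing N D s (F ∘ₗ f) := by
  induction s with
  | zero => simp
  | add s t hs ht => simp only [map_add, LinearMap.add_apply, hs, ht]
  | tmul n d => simp

end Pairing

/-! ### Rational functionals and the predual comodule of a contramodule. -/

namespace LeftContra

section General

variable {k : Type u} [Field k] {C : Type v} [AddCommGroup C] [Module k C] [Coalgebra k C]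

/-- A space of functionals on a contramodule is rational if the contraaction, composed with any
of them, is represented by an element of the tensor product with the coalgebra. -/
def IsRational (P : LeftContra.{u, v, t} k C) (N : Submodule k (Module.Dual k P.carrier)) : Prop :=
  ∀ n : N, ∃ s : N ⊗[k] C, dualPairing N C s = (n : Module.Dual k P.carrier) ∘ₗ P.contraact

variable {P : LeftContra.{u, v, t} k C} {N : Submodule k (Module.Dual k P.carrier)}

/-- The coaction on a rational space of functionals. -/
def IsRational.coact (hN : P.IsRational N) : N →ₗ[k] N ⊗[k] C :=
  (LinearEquiv.ofInjective _ dualPairing_injective).symm.toLinearMap ∘ₗ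
    (P.contraact.dualMap ∘ₗ N.subtype).codRestrict (LinearMap.range (dualPairing N C)) hN

lemma IsRational.dualPairing_coact (hN : P.IsRational N) (n : N) (F : C →ₗ[k] P.carrier) :
    dualPairing N C (hN.coact n) F = (n : Module.Dual k P.carrier) (P.contraact F) := by
  have := (LinearEquiv.ofInjective (dualPairing N C) dualPairing_injective).apply_symm_apply
    ((P.contraact.dualMap ∘ₗ N.subtype).codRestrict (LinearMap.range (dualPairing N C)) hN n)
  exact LinearMap.congr_fun (congrArg Subtype.val this) F

/-- The comodule of a rational space of functionals on a contramodule. -/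
def IsRational.comod {P : LeftContra.{u, v, max u t} k C}
    {N : Submodule k (Module.Dual k P.carrier)} (hN : P.IsRational N) :
    RightComod.{u, v, max u t} k C where
  carrier := N
  coact := hN.coact
  coassoc := by
    -- Paired with a map `H : C ⊗ C → P`, coassociativity becomes contraassociativity for the
    -- curried `H`.
    refine LinearMap.ext fun n => dualPairing_injective (LinearMap.ext fun H => ?_)
    simp only [LinearMap.comp_apply, LinearEquiv.coe_coe]
    have h : ∀ s : N ⊗[k] C, dualPairing N (C ⊗[k] C)
        (TensorProduct.assoc k N C C (hN.coact.rTensor C s)) H =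
        dualPairing N C s (P.contraact ∘ₗ (TensorProduct.curry H).flip) := by
      intro s
      induction s with
      | zero => simp
      | add s t hs ht => simp only [map_add, LinearMap.add_apply, hs, ht]
      | tmul n c =>
        rw [LinearMap.rTensor_tmul, dualPairing_tmul, LinearMap.comp_apply,
          ← hN.dualPairing_coact]
        generalize hN.coact n = s
        induction s with
        | zero => simp
        | add s t hs ht => simp only [map_add, LinearMap.add_apply, hs, ht, TensorProduct.add_tmul]
        | tmul n d => simp
    rw [h, dualPairing_lTensor, hN.dualPairing_coact, hN.dualPairing_coact, P.contraassoc]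
    congr 3
    ext; simp
  coact_counit := by
    refine LinearMap.ext fun n => Subtype.ext (LinearMap.ext fun p => ?_)
    simp only [LinearMap.comp_apply, LinearEquiv.coe_coe, LinearMap.id_apply]
    have h : ∀ s : N ⊗[k] C, (TensorProduct.rid k N
        ((Coalgebra.counit (R := k) (A := C)).lTensor N s) : Module.Dual k P.carrier) p =
        dualPairing N C s ((Coalgebra.counit (R := k)).smulRight p) := by
      intro s
      induction s with
      | zero => simp
      | add s t hs ht => simp only [map_add, LinearMap.add_apply, Submodule.coe_add, hs, ht]
      | tmul n c => simp
    rw [h, hN.dualPairing_coact, P.contraunit]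

/-- The operators on the comodule are transposes of those on the contramodule; through this the
components of the two are compared. -/
lemma IsRational.comod_act {P : LeftContra.{u, v, max u t} k C}
    {N : Submodule k (Module.Dual k P.carrier)} (hN : P.IsRational N) (φ : Module.Dual k C)
    (n : N) (p : P.carrier) :
    N.subtype (hN.comod.act φ n) p =
      (n : Module.Dual k P.carrier) (P.act φ p) := by
  have h : ∀ s : N ⊗[k] C, (TensorProduct.rid k N (φ.lTensor N s) : Module.Dual k P.carrier) p =
      dualPairing N C s (φ.smulRight p) := by
    intro s
    induction s with
    | zero => simp
    | add s t hs ht => simp only [map_add, LinearMap.add_apply, Submodule.coe_add, hs, ht]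
    | tmul n c => simp
  exact (h _).trans (hN.dualPairing_coact n _)

/-- The evaluation morphism from a contramodule to the dual of a comodule of functionals on it. -/
def IsRational.toDual {P : LeftContra.{u, v, max u t} k C}
    {N : Submodule k (Module.Dual k P.carrier)} (hN : P.IsRational N) :
    LeftContra.Hom P (RightComod.dual.{u, v, t} hN.comod) where
  toLinearMap := (N.subtype.flip : P.carrier →ₗ[k] Module.Dual k N)
  comm F := by
    refine LinearMap.ext fun n => ?_
    have h : ∀ s : N ⊗[k] C, TensorProduct.lift
        ((N.subtype.flip : P.carrier →ₗ[k] Module.Dual k N) ∘ₗ F).flip s = dualPairing N C s F := by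
      intro s
      induction s with
      | zero => simp
      | add s t hs ht => simp only [map_add, LinearMap.add_apply, hs, ht]
      | tmul n c => simp
    exact (hN.dualPairing_coact n F).symm.trans (h _).symm

end General

/-- A bijective morphism of contramodules is an isomorphism. -/
def isoOfBijective {k : Type u} [Field k] {C : Type v} [AddCommGroup C] [Module k C]
    [Coalgebra k C] {P Q : LeftContra.{u, v, t} k C} (f : P ⟶ Q)
    (hf : Function.Bijective (LeftContra.Hom.toLinearMap f)) : P ≅ Q where
  hom := f
  inv :=
    { toLinearMap := (LinearEquiv.ofBijective _ hf).symm.toLinearMap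
      comm := fun F => by
        rw [LinearEquiv.coe_coe, LinearEquiv.symm_apply_eq, LinearEquiv.ofBijective_apply, f.comm]
        congr 1
        ext c
        exact ((LinearEquiv.ofBijective _ hf).apply_symm_apply (F c)).symm }
  hom_inv_id := LeftContra.Hom.ext (LinearMap.ext fun p =>
    (LinearEquiv.ofBijective _ hf).symm_apply_apply p)
  inv_hom_id := LeftContra.Hom.ext (LinearMap.ext fun p =>
    (LinearEquiv.ofBijective _ hf).apply_symm_apply p)

open CatCoalg

section

variable {k : Type u} [Field k] {E : Type v} [Category.{w} E] [Preadditive E] [Linear k E]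
  [LocallyFiniteCat k E] (P : LeftContra.{u, max u v w, t} k (CatCoalg k E))

/-- The space of functionals on a contramodule generated by the functionals on its components. -/
def predual : Submodule k (Module.Dual k P.carrier) :=
  ⨆ y, LinearMap.range (P.act (counitAt k y)).rangeRestrict.dualMap

variable {P}

lemma comp_rangeRestrict_mem_predual (y : E) (n : Module.Dual k (P.component y)) :
    n ∘ₗ (P.act (counitAt k y)).rangeRestrict ∈ P.predual :=
  le_iSup (fun y => LinearMap.range (P.act (counitAt k y)).rangeRestrict.dualMap) y ⟨n, rfl⟩

lemma comp_act_mem_predual (y : E) (n : Module.Dual k P.carrier) :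
    n ∘ₗ P.act (counitAt k y) ∈ P.predual :=
  comp_rangeRestrict_mem_predual y (n ∘ₗ (P.component y).subtype)

/-- For a functional on the component at `y`, only the blocks `Hom(z, y)^*` with `z ∈ S` matter.
These are finitely many and finite-dimensional, so bases of the `Hom(z, y)` yield an explicit
tensor. -/
lemma isRational_predual_of_exists
    (hP : ∀ y : E, ∃ S : Finset E, ∀ F : CatCoalg k E →ₗ[k] P.carrier,
      P.contraact (F ∘ₗ sel k fun a b => a ∉ S ∧ b = y) = 0) : P.IsRational P.predual := by
  classical
  suffices h : ∀ n ∈ P.predual, ∃ s : P.predual ⊗[k] CatCoalg k E,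
      dualPairing P.predual _ s = n ∘ₗ P.contraact from fun n => h n n.2
  intro n hn
  induction hn using Submodule.iSup_induction' with
  | zero => exact ⟨0, by simp⟩
  | add n n' _ _ h h' =>
    obtain ⟨s, hs⟩ := h
    obtain ⟨s', hs'⟩ := h'
    exact ⟨s + s', by rw [map_add, hs, hs', LinearMap.add_comp]⟩
  | mem y n hn =>
    obtain ⟨n, rfl⟩ := hn
    obtain ⟨n', hn'⟩ := LinearMap.exists_extend n
    obtain ⟨S, hS⟩ := hP y
    let b := fun z => Module.finBasis k (z ⟶ y)
    refine ⟨∑ z ∈ S, ∑ i, (⟨(n' ∘ₗ P.act (ev (b z i))) ∘ₗ P.act (counitAt k z),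
      comp_act_mem_predual z _⟩ : P.predual) ⊗ₜ[k] incl k z y ((b z).coord i), ?_⟩
    refine LinearMap.ext fun F => ?_
    have h1 : ((P.act (counitAt k y)).rangeRestrict.dualMap n ∘ₗ P.contraact) F =
        n' (P.contraact (F ∘ₗ sel k fun _ b => b = y)) := by
      rw [← act_counitAt_contraact, ← hn']
      rfl
    -- The column of target `y` splits into the negligible part off `S` and one block for each `z ∈
    -- S`.
    have h2 : F ∘ₗ (sel k fun _ b => b = y) = F ∘ₗ (sel k fun a b => a ∉ S ∧ b = y) +
        ∑ z ∈ S, F ∘ₗ sel k fun a b => a = z ∧ b = y := by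
      refine hom_ext fun a c φ => ?_
      rw [LinearMap.add_apply, LinearMap.sum_apply]
      simp only [LinearMap.comp_apply]
      by_cases hc : c = y
      · rw [sel_incl (T := fun _ b => b = y) hc]
        by_cases ha : a ∈ S
        · rw [sel_incl_of_not (T := fun a b => a ∉ S ∧ b = y) (fun e => e.1 ha), map_zero, zero_add,
            Finset.sum_eq_single_of_mem a ha, sel_incl (T := fun a' b => a' = a ∧ b = y) ⟨rfl, hc⟩]
          intro z _ hz
          rw [sel_incl_of_not (T := fun a b => a = z ∧ b = y) (fun e => hz e.1.symm), map_zero]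
        · rw [sel_incl (T := fun a b => a ∉ S ∧ b = y) ⟨ha, hc⟩, Finset.sum_eq_zero, add_zero]
          intro z hz
          rw [sel_incl_of_not (T := fun a b => a = z ∧ b = y), map_zero]
          rintro ⟨rfl, -⟩
          exact ha hz
      · rw [sel_incl_of_not (T := fun _ b => b = y) hc, map_zero,
          sel_incl_of_not (T := fun a b => a ∉ S ∧ b = y) (fun e => hc e.2), map_zero, zero_add,
          Finset.sum_eq_zero]
        intro z _
        rw [sel_incl_of_not (T := fun a b => a = z ∧ b = y) (fun e => hc e.2), map_zero]
    -- On one block, `F` is determined by its values on the dual basis. The extra projection by ε_z,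
    -- harmless by `contraact_eq_row`, makes the resulting functionals factor through a component,
    -- hence lie in the predual.
    have h3 : ∀ z, P.contraact (F ∘ₗ sel k fun a b => a = z ∧ b = y) =
        ∑ i, P.act (ev (b z i)) (P.act (counitAt k z) (F (incl k z y ((b z).coord i)))) := by
      intro z
      rw [contraact_eq_row]
      simp only [act_apply _ (ev _)]
      rw [← map_sum]
      congr 1
      refine hom_ext fun a c φ => ?_
      rw [desc_incl, LinearMap.sum_apply]
      simp only [LinearMap.comp_apply, LinearMap.smulRight_apply]
      by_cases hac : a = z ∧ c = y
      · rw [sel_incl (T := fun a b => a = z ∧ b = y) hac]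
        obtain ⟨rfl, rfl⟩ := hac
        simp only [ev_incl_self]
        conv_lhs => rw [← (b a).sum_dual_apply_smul_coord φ]
        simp only [map_sum, map_smul]
      · rw [sel_incl_of_not (T := fun a b => a = z ∧ b = y) hac, map_zero, map_zero,
          Finset.sum_eq_zero]
        intro i _
        rw [ev_incl_of_ne _ hac, zero_smul]
    rw [h1, h2, map_add, hS F, zero_add, map_sum, map_sum, map_sum, LinearMap.sum_apply]
    refine Finset.sum_congr rfl fun z _ => ?_
    rw [h3, map_sum, map_sum, LinearMap.sum_apply]
    exact Finset.sum_congr rfl fun i _ => rfl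

end

variable {k : Type u} [Field k] {E : Type v} [Category.{w} E] [Preadditive E] [Linear k E]
  [LocallyFiniteCat k E] {P : LeftContra.{u, max u v w, max u t} k (CatCoalg k E)}

/-- A functional in the component at `x` has the form `n ∘ ε_x`, so by idempotence it is determined
by its restriction to the component of `P` at `x`, whose dual is finite-dimensional. -/
lemma isLocallyFinite_comod_predual (hN : P.IsRational P.predual)
    (hP : IsLocallyFiniteLeftContra.{u, v, w, max u t} k E P) :
    IsLocallyFiniteRightComod.{u, v, w, max u t} k E hN.comod := by
  intro x
  have hx : FiniteDimensional k (P.component x) := hP x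
  let r : P.predual →ₗ[k] Module.Dual k (P.component x) :=
    (P.component x).subtype.dualMap ∘ₗ P.predual.subtype
  have hr : ∀ n ∈ hN.comod.component x, r n = 0 → n = 0 := by
    rintro _ ⟨(n : P.predual), rfl⟩ h0
    refine Subtype.ext (LinearMap.ext fun p => ?_)
    have h1 : (n : Module.Dual k P.carrier) (P.act (counitAt k x) (P.act (counitAt k x) p)) = 0 := by
      rw [← hN.comod_act]
      exact LinearMap.congr_fun h0 ⟨P.act (counitAt k x) p, p, rfl⟩
    rw [act_counitAt_idem] at h1
    exact (hN.comod_act _ n p).trans h1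
  refine FiniteDimensional.of_injective (r ∘ₗ (hN.comod.component x).subtype)
    ((injective_iff_map_eq_zero _).2 fun n hn => Subtype.ext (hr n n.2 hn))

/-- The dual of a sum of duals is a product of double duals; reflexivity of the components and the
product decomposition of `P` do the rest. -/
lemma toDual_bijective (hN : P.IsRational P.predual)
    (hP : IsLocallyFiniteLeftContra.{u, v, w, max u t} k E P) :
    Function.Bijective hN.toDual.toLinearMap := by
  constructor
  · refine (injective_iff_map_eq_zero _).2 fun p hp => eq_zero_of_act_counitAt P fun x => ?_
    rw [← Module.forall_dual_apply_eq_zero_iff k]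
    intro n
    exact LinearMap.congr_fun hp ⟨_, comp_act_mem_predual x n⟩
  · intro (l : Module.Dual k P.predual)
    -- Restricted to the functionals through one component, `l` is evaluation at a vector, by
    -- reflexivity.
    have hl : ∀ y, ∃ p : P.component y, ∀ n : Module.Dual k (P.component y),
        l ⟨_, comp_rangeRestrict_mem_predual y n⟩ = n p := by
      intro y
      have hy : FiniteDimensional k (P.component y) := hP y
      obtain ⟨p, hp⟩ := (Module.evalEquiv k (P.component y)).surjective
        (l ∘ₗ
          ((P.act (counitAt k y)).rangeRestrict.dualMap.codRestrict P.predual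
            (comp_rangeRestrict_mem_predual y)))
      exact ⟨p, fun n => (LinearMap.congr_fun hp n).symm⟩
    choose p hp using hl
    obtain ⟨q, hq⟩ := exists_act_counitAt_eq P p
    refine ⟨q, ?_⟩
    have h : ∀ n (hn : n ∈ P.predual), n q = l ⟨n, hn⟩ := by
      intro n hn
      induction hn using Submodule.iSup_induction' with
      | zero => exact (map_zero l).symm
      | add n n' hn hn' h h' =>
        rw [LinearMap.add_apply, h, h']
        exact (map_add l ⟨n, hn⟩ ⟨n', hn'⟩).symm
      | mem y n hn =>
        obtain ⟨n, rfl⟩ := hn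
        refine Eq.trans ?_ (hp y n).symm
        exact congrArg n (Subtype.ext (hq y))
    exact LinearMap.ext fun (n : P.predual) => h n n.2

end LeftContra

/-! ### Full faithfulness of dualization. -/

namespace RightComod

section General

variable {k : Type u} [Field k] {C : Type v} [AddCommGroup C] [Module k C] [Coalgebra k C]

lemma act_apply (N : RightComod.{u, v, t} k C) (φ : Module.Dual k C) (n : N.carrier) :
    N.act φ n = TensorProduct.rid k N.carrier (φ.lTensor N.carrier (N.coact n)) := rfl

lemma act_comm {M N : RightComod.{u, v, t} k C} (g : RightComod.Hom M N) (φ : Module.Dual k C)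
    (m : M.carrier) : g.toLinearMap (M.act φ m) = N.act φ (g.toLinearMap m) := by
  have h : N.coact (g.toLinearMap m) = g.toLinearMap.rTensor C (M.coact m) :=
    LinearMap.congr_fun g.comm m
  rw [act_apply, act_apply, h]
  generalize M.coact m = s
  induction s with
  | zero => simp
  | add s t hs ht => simp only [map_add, hs, ht]
  | tmul m c => simp

/-- A linear map whose dual is a morphism of contramodules is a morphism of comodules. -/
lemma comm_of_dualMap {M N : RightComod.{u, v, t} k C} (g : M.carrier →ₗ[k] N.carrier)
    (h : ∀ f : C →ₗ[k] Module.Dual k N.carrier,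
      g.dualMap (N.dualContraact f) = M.dualContraact (g.dualMap ∘ₗ f)) :
    N.coact ∘ₗ g = g.rTensor C ∘ₗ M.coact := by
  refine LinearMap.ext fun m => ?_
  rw [← sub_eq_zero, ← Module.forall_dual_apply_eq_zero_iff k]
  intro l
  rw [map_sub, sub_eq_zero]
  -- Every functional on `N ⊗ C` is a map `C → N^*` in curried form, so the hypothesis tests the two
  -- sides against all functionals.
  have h1 := LinearMap.congr_fun (h (TensorProduct.curry l).flip) m
  rw [LinearMap.dualMap_apply, dualContraact_apply, dualContraact_apply] at h1
  have h2 : TensorProduct.lift (TensorProduct.curry l).flip.flip = l := by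
    ext; simp
  have h3 : TensorProduct.lift (g.dualMap ∘ₗ (TensorProduct.curry l).flip).flip =
      l ∘ₗ g.rTensor C := by
    ext; simp
  rw [h2, h3] at h1
  exact h1

end General

open CatCoalg

variable {k : Type u} [Field k] {E : Type v} [Category.{w} E] [Preadditive E] [Linear k E]
  [LocallyFiniteCat k E]

/-- A comodule over the coalgebra of a category is spanned by its components. -/
lemma iSup_component_eq_top (N : RightComod.{u, max u v w, t} k (CatCoalg k E)) :
    ⨆ x, N.component x = ⊤ := by
  classical
  -- The counit is the sum of the ε_x, finite on each tensor. Allowing every larger index set lets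
  -- the sets for two summands be merged.
  have h : ∀ s : N.carrier ⊗[k] CatCoalg k E, ∃ S : Finset E, ∀ S', S ⊆ S' →
      (Coalgebra.counit (R := k)).lTensor N.carrier s =
        ∑ x ∈ S', (counitAt k x).lTensor N.carrier s := by
    intro s
    induction s with
    | zero => exact ⟨∅, fun _ _ => by simp⟩
    | add s t hs ht =>
      obtain ⟨S, hS⟩ := hs
      obtain ⟨T, hT⟩ := ht
      refine ⟨S ∪ T, fun S' h => ?_⟩
      simp only [map_add, hS S' (Finset.union_subset_left h),
        hT S' (Finset.union_subset_right h), Finset.sum_add_distrib]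
    | tmul n c =>
      obtain ⟨S, hS⟩ := exists_counit_eq_sum c
      refine ⟨S, fun S' h => ?_⟩
      simp only [LinearMap.lTensor_tmul]
      rw [hS S' h, TensorProduct.tmul_sum]
  rw [eq_top_iff]
  intro n _
  obtain ⟨S, hS⟩ := h (N.coact n)
  have hn : n = TensorProduct.rid k N.carrier
      ((Coalgebra.counit (R := k)).lTensor N.carrier (N.coact n)) :=
    (LinearMap.congr_fun N.coact_counit n).symm
  rw [hn, hS S (Finset.Subset.refl S), map_sum]
  exact Submodule.sum_mem _ fun x _ =>
    le_iSup (fun x => N.component x) x ⟨n, rfl⟩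

/-- Every morphism between the duals of locally finite comodules is dual to a morphism. -/
lemma exists_dual_eq {M N : RightComod.{u, max u v w, max u t} k (CatCoalg k E)}
    (hN : IsLocallyFiniteRightComod.{u, v, w, max u t} k E N)
    (φ : LeftContra.Hom (RightComod.dual.{u, max u v w, t} N)
      (RightComod.dual.{u, max u v w, t} M)) :
    ∃ g : RightComod.Hom M N, RightComod.Hom.dual.{u, max u v w, t} g = φ := by
  set Φ : Module.Dual k N.carrier →ₗ[k] Module.Dual k M.carrier := φ.toLinearMap with hΦ
  have hact : ∀ x (f : Module.Dual k N.carrier) (m : M.carrier),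
      Φ f (M.act (counitAt k x) m) = Φ (f ∘ₗ N.act (counitAt k x)) m := by
    intro x f m
    have h := LeftContra.act_comm φ (counitAt k x) f
    rw [RightComod.dual_act, RightComod.dual_act] at h
    exact (LinearMap.congr_fun h m).symm
  -- It suffices to treat `m` in one component. There `Φ f m` depends only on the restriction of `f`
  -- to the component of `N` at `x`, since `Φ` commutes with ε_x, and that component is reflexive.
  have hex : ∀ m, ∃ n : N.carrier, ∀ f, Φ f m = f n := by
    intro m
    have hm : m ∈ ⨆ x, M.component x := by rw [iSup_component_eq_top]; trivial
    induction hm using Submodule.iSup_induction' with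
    | zero => exact ⟨0, fun f => by rw [map_zero, map_zero]⟩
    | add m m' _ _ h h' =>
      obtain ⟨n, hn⟩ := h
      obtain ⟨n', hn'⟩ := h'
      exact ⟨n + n', fun f => by rw [map_add, map_add, hn, hn']⟩
    | mem x m hm =>
      obtain ⟨m, rfl⟩ := hm
      have hx : FiniteDimensional k (N.component x) := hN x
      obtain ⟨n, hn⟩ := (Module.evalEquiv k (N.component x)).surjective
        (Module.Dual.eval k _ m ∘ₗ Φ ∘ₗ (N.act (counitAt k x)).rangeRestrict.dualMap)
      refine ⟨n, fun f => ?_⟩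
      rw [hact]
      exact (LinearMap.congr_fun hn (f ∘ₗ (N.component x).subtype)).symm
  choose g hg using hex
  let G : M.carrier →ₗ[k] N.carrier :=
    { toFun := g
      map_add' := fun m m' => by
        rw [← sub_eq_zero, ← Module.forall_dual_apply_eq_zero_iff k]
        intro f
        rw [map_sub, map_add, ← hg, ← hg, ← hg, map_add, sub_self]
      map_smul' := fun r m => by
        rw [← sub_eq_zero, ← Module.forall_dual_apply_eq_zero_iff k]
        intro f
        rw [map_sub, RingHom.id_apply, map_smul, ← hg, ← hg, map_smul, sub_self] }
  have hG : G.dualMap = Φ := LinearMap.ext fun f => LinearMap.ext fun m => (hg m f).symm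
  refine ⟨⟨G, comm_of_dualMap G fun f => ?_⟩, LeftContra.Hom.ext hG⟩
  rw [hG]
  exact φ.comm f

lemma dual_injective {M N : RightComod.{u, max u v w, max u t} k (CatCoalg k E)}
    {g h : RightComod.Hom M N} (e : RightComod.Hom.dual.{u, max u v w, t} g =
      RightComod.Hom.dual.{u, max u v w, t} h) : g = h := by
  have e' : g.toLinearMap.dualMap = h.toLinearMap.dualMap := congrArg LeftContra.Hom.toLinearMap e
  refine RightComod.Hom.ext (LinearMap.ext fun m => ?_)
  rw [← sub_eq_zero, ← Module.forall_dual_apply_eq_zero_iff k]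
  intro f
  rw [map_sub, sub_eq_zero]
  exact LinearMap.congr_fun (LinearMap.congr_fun e' f) m

end RightComod

theorem lfDualFunctor_isEquivalence {k : Type u} [Field k] {E : Type v} [Category.{w} E]
    [Preadditive E] [Linear k E] [LeftStrictlyLocallyFiniteCat k E] :
    (lfDualFunctor.{u, v, w, max v w t} k E).IsEquivalence where
  faithful := ⟨fun {M N} g h e => Quiver.Hom.unop_inj (ObjectProperty.hom_ext _
    (RightComod.dual_injective.{u, v, w, max v w t} (congrArg InducedCategory.Hom.hom e)))⟩
  full := ⟨fun {M N} φ => by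
    obtain ⟨g, hg⟩ := RightComod.exists_dual_eq.{u, v, w, max v w t} M.unop.property φ.hom
    exact ⟨Quiver.Hom.op (ObjectProperty.homMk g), ObjectProperty.hom_ext _ hg⟩⟩
  essSurj := ⟨fun P => by
    have hP : P.obj.IsRational P.obj.predual := LeftContra.isRational_predual_of_exists
      (LeftContra.exists_finset_contraact_eq_zero P.property)
    exact ⟨Opposite.op ⟨hP.comod,
        LeftContra.isLocallyFinite_comod_predual.{u, v, w, max v w t} hP P.property⟩,
      ⟨(ObjectProperty.isoMk _ (LeftContra.isoOfBijective hP.toDual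
        (LeftContra.toDual_bijective.{u, v, w, max v w t} hP P.property))).symm⟩⟩⟩

lemma LinearMap.exists_lift_of_injective {k U V W : Type*} [Field k] [AddCommGroup U] [Module k U]
    [AddCommGroup V] [Module k V] [AddCommGroup W] [Module k W] (f : U →ₗ[k] W) (j : V →ₗ[k] W)
    (hj : Function.Injective j) (h : ∀ x, f x ∈ LinearMap.range j) :
    ∃ c : U →ₗ[k] V, j ∘ₗ c = f := by
  refine ⟨(LinearEquiv.ofInjective j hj).symm.toLinearMap ∘ₗ f.codRestrict _ h, ?_⟩
  ext x
  exact congrArg Subtype.val ((LinearEquiv.ofInjective j hj).apply_symm_apply (f.codRestrict _ h x))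

/-! ### Abelian categories of comodules and of locally finite comodules. -/

namespace RightComod

open Limits

/-- Neither `c` nor `d` is assumed coassociative, so this can serve to transfer coassociativity
along injections and surjections. -/
lemma rTensor_assoc_rTensor {k : Type*} [Field k] {C V W : Type*} [AddCommGroup C] [Module k C]
    [AddCommGroup V] [Module k V] [AddCommGroup W] [Module k W]
    {c : V →ₗ[k] V ⊗[k] C} {d : W →ₗ[k] W ⊗[k] C} {f : V →ₗ[k] W} (h : d ∘ₗ f = f.rTensor C ∘ₗ c) (v : V) :
    f.rTensor (C ⊗[k] C) (TensorProduct.assoc k V C C (c.rTensor C (c v))) =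
      TensorProduct.assoc k W C C (d.rTensor C (d (f v))) := by
  rw [show d (f v) = f.rTensor C (c v) from LinearMap.congr_fun h v]
  generalize c v = s
  induction s with
  | zero => simp
  | add s t hs ht => simp only [map_add, hs, ht]
  | tmul m a =>
    rw [LinearMap.rTensor_tmul, LinearMap.rTensor_tmul, LinearMap.rTensor_tmul,
      show d (f m) = f.rTensor C (c m) from LinearMap.congr_fun h m]
    generalize c m = s
    induction s with
    | zero => simp
    | add s t hs ht => simp only [map_add, TensorProduct.add_tmul, hs, ht]
    | tmul m b => simp

section General

variable {k : Type u} [Field k] {C : Type v} [AddCommGroup C] [Module k C] [Coalgebra k C]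

/-! ### The preadditive structure -/

/-- The subgroup of morphisms of comodules in the group of linear maps. -/
def homSubgroup (M N : RightComod.{u, v, t} k C) : AddSubgroup (M.carrier →ₗ[k] N.carrier) where
  carrier := {f | N.coact ∘ₗ f = f.rTensor C ∘ₗ M.coact}
  zero_mem' := by simp
  add_mem' {f g} hf hg := by
    simp only [Set.mem_ofPred_eq] at *
    rw [LinearMap.comp_add, hf, hg, LinearMap.rTensor_add, LinearMap.add_comp]
  neg_mem' {f} hf := by
    simp only [Set.mem_ofPred_eq] at *
    rw [LinearMap.comp_neg, hf, LinearMap.rTensor_neg, LinearMap.neg_comp]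

/-- Morphisms of comodules as elements of a subgroup of the group of linear maps. -/
def homEquiv (M N : RightComod.{u, v, t} k C) : (M ⟶ N) ≃ homSubgroup M N where
  toFun f := ⟨Hom.toLinearMap f, Hom.comm f⟩
  invFun f := Hom.mk f.1 f.2
  left_inv _ := rfl
  right_inv _ := rfl

instance (M N : RightComod.{u, v, t} k C) : AddCommGroup (M ⟶ N) := (homEquiv M N).addCommGroup

lemma hom_ext {M N : RightComod.{u, v, t} k C} {f g : M ⟶ N}
    (h : Hom.toLinearMap f = Hom.toLinearMap g) : f = g :=
  Hom.ext h

lemma toLinearMap_add {M N : RightComod.{u, v, t} k C} (f g : M ⟶ N) :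
    Hom.toLinearMap (f + g) = Hom.toLinearMap f + Hom.toLinearMap g := rfl

lemma toLinearMap_zero (M N : RightComod.{u, v, t} k C) :
    Hom.toLinearMap (0 : M ⟶ N) = 0 := rfl

lemma toLinearMap_comp {L M N : RightComod.{u, v, t} k C} (f : L ⟶ M) (g : M ⟶ N) :
    Hom.toLinearMap (f ≫ g) = Hom.toLinearMap g ∘ₗ Hom.toLinearMap f := rfl

instance : Preadditive (RightComod.{u, v, t} k C) where
  add_comp _ _ _ f f' g := hom_ext (by
    rw [toLinearMap_comp, toLinearMap_add, toLinearMap_add, LinearMap.comp_add]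
    rfl)
  comp_add _ _ _ f g g' := hom_ext (by
    rw [toLinearMap_comp, toLinearMap_add, toLinearMap_add, LinearMap.add_comp]
    rfl)

/-! ### Subcomodules and quotient comodules -/

section Transfer

variable {V W : Type t} [AddCommGroup V] [Module k V] [AddCommGroup W] [Module k W]
  {c : V →ₗ[k] V ⊗[k] C} {d : W →ₗ[k] W ⊗[k] C} {f : V →ₗ[k] W}

lemma rTensor_lTensor_comul (h : d ∘ₗ f = f.rTensor C ∘ₗ c) (v : V) :
    f.rTensor (C ⊗[k] C) ((Coalgebra.comul (R := k) (A := C)).lTensor V (c v)) =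
      (Coalgebra.comul (R := k) (A := C)).lTensor W (d (f v)) := by
  rw [show d (f v) = f.rTensor C (c v) from LinearMap.congr_fun h v]
  generalize c v = s
  induction s with
  | zero => simp
  | add s t hs ht => simp only [map_add, hs, ht]
  | tmul m a => simp

lemma apply_rid_lTensor_counit (h : d ∘ₗ f = f.rTensor C ∘ₗ c) (v : V) :
    f (TensorProduct.rid k V ((Coalgebra.counit (R := k) (A := C)).lTensor V (c v))) =
      TensorProduct.rid k W ((Coalgebra.counit (R := k) (A := C)).lTensor W (d (f v))) := by
  rw [show d (f v) = f.rTensor C (c v) from LinearMap.congr_fun h v]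
  generalize c v = s
  induction s with
  | zero => simp
  | add s t hs ht => simp only [map_add, hs, ht]
  | tmul m a => simp

end Transfer

/-- The comodule structure on a vector space embedded into a comodule. -/
def ofInjective (M : RightComod.{u, v, t} k C) {V : Type t} [AddCommGroup V] [Module k V]
    (i : V →ₗ[k] M.carrier) (hi : Function.Injective i) (c : V →ₗ[k] V ⊗[k] C)
    (h : M.coact ∘ₗ i = i.rTensor C ∘ₗ c) : RightComod.{u, v, t} k C where
  carrier := V
  coact := c
  coassoc := LinearMap.ext fun v => by
    apply Module.Flat.rTensor_preserves_injective_linearMap (M := C ⊗[k] C) i hi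
    simp only [LinearMap.comp_apply, LinearEquiv.coe_coe]
    rw [rTensor_assoc_rTensor h, rTensor_lTensor_comul h]
    exact LinearMap.congr_fun M.coassoc (i v)
  coact_counit := LinearMap.ext fun v => by
    apply hi
    simp only [LinearMap.comp_apply, LinearEquiv.coe_coe]
    rw [apply_rid_lTensor_counit h]
    exact LinearMap.congr_fun M.coact_counit (i v)

/-- The comodule structure on a quotient vector space of a comodule. -/
def ofSurjective (M : RightComod.{u, v, t} k C) {V : Type t} [AddCommGroup V] [Module k V]
    (q : M.carrier →ₗ[k] V) (hq : Function.Surjective q) (c : V →ₗ[k] V ⊗[k] C)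
    (h : c ∘ₗ q = q.rTensor C ∘ₗ M.coact) : RightComod.{u, v, t} k C where
  carrier := V
  coact := c
  coassoc := LinearMap.ext fun v => by
    obtain ⟨m, rfl⟩ := hq v
    simp only [LinearMap.comp_apply, LinearEquiv.coe_coe]
    rw [← rTensor_assoc_rTensor h, ← rTensor_lTensor_comul h]
    exact congrArg _ (LinearMap.congr_fun M.coassoc m)
  coact_counit := LinearMap.ext fun v => by
    obtain ⟨m, rfl⟩ := hq v
    simp only [LinearMap.comp_apply, LinearEquiv.coe_coe]
    rw [← apply_rid_lTensor_counit h]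
    exact congrArg _ (LinearMap.congr_fun M.coact_counit m)

/-- Tensoring over a field is exact, so the coaction carries the linear kernel of `g` into its
tensor product with `C`. -/
lemma exists_injective_exact {M N : RightComod.{u, v, t} k C} (g : M ⟶ N) :
    ∃ (K : RightComod.{u, v, t} k C) (i : K ⟶ M), Function.Injective (Hom.toLinearMap i) ∧
      LinearMap.range (Hom.toLinearMap i) = LinearMap.ker (Hom.toLinearMap g) := by
  set G := Hom.toLinearMap g with hG
  have hinj := Module.Flat.rTensor_preserves_injective_linearMap (M := C) (LinearMap.ker G).subtype
    Subtype.val_injective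
  obtain ⟨c, hc⟩ := LinearMap.exists_lift_of_injective (M.coact ∘ₗ (LinearMap.ker G).subtype)
    ((LinearMap.ker G).subtype.rTensor C) hinj (fun x => by
      have hex : Function.Exact ((LinearMap.ker G).subtype.rTensor C) (G.rTensor C) :=
        Module.Flat.rTensor_exact C (LinearMap.exact_subtype_ker_map G)
      refine (hex _).1 ?_
      have h1 : N.coact (G x) = G.rTensor C (M.coact x) := LinearMap.congr_fun (Hom.comm g) x
      rw [LinearMap.comp_apply, Submodule.subtype_apply, ← h1, LinearMap.mem_ker.1 x.2, map_zero])
  exact ⟨M.ofInjective _ Subtype.val_injective c hc.symm, Hom.mk (LinearMap.ker G).subtype hc.symm,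
    Subtype.val_injective, Submodule.range_subtype _⟩

lemma exists_surjective_exact {M N : RightComod.{u, v, t} k C} (g : M ⟶ N) :
    ∃ (Q : RightComod.{u, v, t} k C) (q : N ⟶ Q), Function.Surjective (Hom.toLinearMap q) ∧
      LinearMap.ker (Hom.toLinearMap q) = LinearMap.range (Hom.toLinearMap g) := by
  set G := Hom.toLinearMap g with hG
  set c := (LinearMap.range G).liftQ ((LinearMap.range G).mkQ.rTensor C ∘ₗ N.coact) (by
      rintro _ ⟨m, rfl⟩
      have h1 : N.coact (G m) = G.rTensor C (M.coact m) := LinearMap.congr_fun (Hom.comm g) m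
      rw [LinearMap.mem_ker, LinearMap.comp_apply, h1, ← LinearMap.comp_apply,
        ← LinearMap.rTensor_comp, LinearMap.range_mkQ_comp, LinearMap.rTensor_zero,
        LinearMap.zero_apply]) with hc
  have h : c ∘ₗ (LinearMap.range G).mkQ = (LinearMap.range G).mkQ.rTensor C ∘ₗ N.coact :=
    Submodule.liftQ_mkQ _ _ _
  exact ⟨N.ofSurjective _ (Submodule.mkQ_surjective _) c h, Hom.mk (LinearMap.range G).mkQ h,
    Submodule.mkQ_surjective _, Submodule.ker_mkQ _⟩

/-! ### Kernels and cokernels -/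

/-- The linear lift respects coactions automatically, as can be checked after the injective map `i ⊗
C`. -/
lemma exists_lift {K M T : RightComod.{u, v, t} k C} (i : K ⟶ M)
    (hi : Function.Injective (Hom.toLinearMap i)) (f : T ⟶ M)
    (h : LinearMap.range (Hom.toLinearMap f) ≤ LinearMap.range (Hom.toLinearMap i)) :
    ∃ l : T ⟶ K, l ≫ i = f := by
  obtain ⟨l, hl⟩ := LinearMap.exists_lift_of_injective (Hom.toLinearMap f) (Hom.toLinearMap i) hi
    (fun x => h ⟨x, rfl⟩)
  refine ⟨Hom.mk l (LinearMap.ext fun x => ?_), hom_ext hl⟩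
  apply Module.Flat.rTensor_preserves_injective_linearMap (M := C) _ hi
  have h1 : M.coact (Hom.toLinearMap i (l x)) = (Hom.toLinearMap i).rTensor C (K.coact (l x)) :=
    LinearMap.congr_fun (Hom.comm i) (l x)
  have h2 : M.coact (Hom.toLinearMap f x) = (Hom.toLinearMap f).rTensor C (T.coact x) :=
    LinearMap.congr_fun (Hom.comm f) x
  rw [LinearMap.comp_apply, ← h1, LinearMap.comp_apply, ← LinearMap.comp_apply (LinearMap.rTensor _ _),
    ← LinearMap.rTensor_comp, hl, ← h2]
  exact congrArg _ (LinearMap.congr_fun hl x)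

lemma exists_desc {N Q T : RightComod.{u, v, t} k C} (q : N ⟶ Q)
    (hq : Function.Surjective (Hom.toLinearMap q)) (f : N ⟶ T)
    (h : LinearMap.ker (Hom.toLinearMap q) ≤ LinearMap.ker (Hom.toLinearMap f)) :
    ∃ l : Q ⟶ T, q ≫ l = f := by
  obtain ⟨l, hl⟩ := LinearMap.exists_comp_eq_of_ker_le_ker (Hom.toLinearMap f) (Hom.toLinearMap q) h
  refine ⟨Hom.mk l (LinearMap.ext fun y => ?_), hom_ext hl⟩
  obtain ⟨x, rfl⟩ := hq y
  have h1 : Q.coact (Hom.toLinearMap q x) = (Hom.toLinearMap q).rTensor C (N.coact x) :=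
    LinearMap.congr_fun (Hom.comm q) x
  have h2 : T.coact (Hom.toLinearMap f x) = (Hom.toLinearMap f).rTensor C (N.coact x) :=
    LinearMap.congr_fun (Hom.comm f) x
  rw [LinearMap.comp_apply, LinearMap.comp_apply, h1, ← LinearMap.comp_apply (LinearMap.rTensor _ _),
    ← LinearMap.rTensor_comp, hl, ← h2, ← hl, LinearMap.comp_apply]

lemma mono_of_injective {M N : RightComod.{u, v, t} k C} (f : M ⟶ N)
    (hf : Function.Injective (Hom.toLinearMap f)) : Mono f :=
  ⟨fun _ _ h => hom_ext (LinearMap.ext fun x =>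
    hf (LinearMap.congr_fun (congrArg Hom.toLinearMap h) x))⟩

lemma epi_of_surjective {M N : RightComod.{u, v, t} k C} (f : M ⟶ N)
    (hf : Function.Surjective (Hom.toLinearMap f)) : Epi f :=
  ⟨fun _ _ h => hom_ext (LinearMap.ext fun y => by
    obtain ⟨x, rfl⟩ := hf y
    exact LinearMap.congr_fun (congrArg Hom.toLinearMap h) x)⟩

/-- An injective morphism onto the kernel of a linear map is a kernel. -/
def isLimitKernelFork {K M N : RightComod.{u, v, t} k C} (i : K ⟶ M) (g : M ⟶ N) (w : i ≫ g = 0)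
    (hi : Function.Injective (Hom.toLinearMap i))
    (h : LinearMap.ker (Hom.toLinearMap g) ≤ LinearMap.range (Hom.toLinearMap i)) :
    IsLimit (KernelFork.ofι i w) :=
  have := mono_of_injective i hi
  have H : ∀ {T : RightComod.{u, v, t} k C} (f : T ⟶ M), f ≫ g = 0 → ∃ l : T ⟶ K, l ≫ i = f :=
    fun f hf => exists_lift i hi f (le_trans (by
      rintro _ ⟨x, rfl⟩
      exact LinearMap.congr_fun (congrArg Hom.toLinearMap hf) x) h)
  KernelFork.IsLimit.ofι' i w fun f hf => ⟨(H f hf).choose, (H f hf).choose_spec⟩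

/-- A surjective morphism with kernel the range of a linear map is a cokernel. -/
def isColimitCokernelCofork {M N Q : RightComod.{u, v, t} k C} (g : M ⟶ N) (q : N ⟶ Q)
    (w : g ≫ q = 0) (hq : Function.Surjective (Hom.toLinearMap q))
    (h : LinearMap.ker (Hom.toLinearMap q) ≤ LinearMap.range (Hom.toLinearMap g)) :
    IsColimit (CokernelCofork.ofπ q w) :=
  have := epi_of_surjective q hq
  have H : ∀ {T : RightComod.{u, v, t} k C} (f : N ⟶ T), g ≫ f = 0 → ∃ l : Q ⟶ T, q ≫ l = f :=
    fun f hf => exists_desc q hq f (le_trans h (by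
      rintro _ ⟨x, rfl⟩
      exact LinearMap.congr_fun (congrArg Hom.toLinearMap hf) x))
  CokernelCofork.IsColimit.ofπ' q w fun f hf => ⟨(H f hf).choose, (H f hf).choose_spec⟩

lemma comp_eq_zero_of_range_le_ker {L M N : RightComod.{u, v, t} k C} (f : L ⟶ M) (g : M ⟶ N)
    (h : LinearMap.range (Hom.toLinearMap f) ≤ LinearMap.ker (Hom.toLinearMap g)) : f ≫ g = 0 :=
  hom_ext (LinearMap.ext fun x => h ⟨x, rfl⟩)

instance : HasKernels (RightComod.{u, v, t} k C) where
  has_limit g := by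
    obtain ⟨K, i, hi, h⟩ := exists_injective_exact g
    exact ⟨⟨⟨_, isLimitKernelFork i g (comp_eq_zero_of_range_le_ker _ _ h.le) hi h.ge⟩⟩⟩

instance : HasCokernels (RightComod.{u, v, t} k C) where
  has_colimit g := by
    obtain ⟨Q, q, hq, h⟩ := exists_surjective_exact g
    exact ⟨⟨⟨_, isColimitCokernelCofork g q (comp_eq_zero_of_range_le_ker _ _ h.ge) hq h.le⟩⟩⟩

/-- The inclusion of the linear kernel is a comodule morphism killed by `f`, hence zero. -/
lemma injective_of_mono {M N : RightComod.{u, v, t} k C} (f : M ⟶ N) [Mono f] :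
    Function.Injective (Hom.toLinearMap f) := by
  obtain ⟨K, i, hi, h⟩ := exists_injective_exact f
  have h0 : i = 0 := zero_of_comp_mono f (comp_eq_zero_of_range_le_ker _ _ h.le)
  rw [← LinearMap.ker_eq_bot, ← h, h0, toLinearMap_zero, LinearMap.range_zero]

lemma surjective_of_epi {M N : RightComod.{u, v, t} k C} (f : M ⟶ N) [Epi f] :
    Function.Surjective (Hom.toLinearMap f) := by
  obtain ⟨Q, q, hq, h⟩ := exists_surjective_exact f
  have h0 : q = 0 := zero_of_epi_comp f (comp_eq_zero_of_range_le_ker _ _ h.ge)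
  rw [← LinearMap.range_eq_top, ← h, h0, toLinearMap_zero, LinearMap.ker_zero]

instance : IsNormalMonoCategory (RightComod.{u, v, t} k C) where
  normalMonoOfMono f _ := by
    obtain ⟨Q, q, hq, h⟩ := exists_surjective_exact f
    exact ⟨⟨Q, q, comp_eq_zero_of_range_le_ker _ _ h.ge,
      isLimitKernelFork f q _ (injective_of_mono f) h.le⟩⟩

instance : IsNormalEpiCategory (RightComod.{u, v, t} k C) where
  normalEpiOfEpi f _ := by
    obtain ⟨K, i, hi, h⟩ := exists_injective_exact f
    exact ⟨⟨K, i, comp_eq_zero_of_range_le_ker _ _ h.le,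
      isColimitCokernelCofork i f _ (surjective_of_epi f) h.ge⟩⟩

/-! ### Finite products -/

/-- The zero comodule. -/
def zeroObj (k : Type u) [Field k] (C : Type v) [AddCommGroup C] [Module k C] [Coalgebra k C] :
    RightComod.{u, v, t} k C where
  carrier := PUnit
  coact := 0
  coassoc := by simp
  coact_counit := LinearMap.ext fun _ => rfl

lemma isZero_zeroObj : IsZero (zeroObj.{u, v, t} k C) := by
  rw [IsZero.iff_id_eq_zero]
  exact hom_ext (LinearMap.ext fun _ => rfl)

instance : HasZeroObject (RightComod.{u, v, t} k C) := ⟨_, isZero_zeroObj⟩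

/-- The coaction on the direct sum of two comodules. -/
def prodCoact (M N : RightComod.{u, v, t} k C) :
    M.carrier × N.carrier →ₗ[k] (M.carrier × N.carrier) ⊗[k] C :=
  ((LinearMap.inl k M.carrier N.carrier).rTensor C ∘ₗ M.coact).coprod
    ((LinearMap.inr k M.carrier N.carrier).rTensor C ∘ₗ N.coact)

lemma prodCoact_comp_inl (M N : RightComod.{u, v, t} k C) :
    prodCoact M N ∘ₗ LinearMap.inl k M.carrier N.carrier =
      (LinearMap.inl k M.carrier N.carrier).rTensor C ∘ₗ M.coact :=
  LinearMap.coprod_inl _ _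

lemma prodCoact_comp_inr (M N : RightComod.{u, v, t} k C) :
    prodCoact M N ∘ₗ LinearMap.inr k M.carrier N.carrier =
      (LinearMap.inr k M.carrier N.carrier).rTensor C ∘ₗ N.coact :=
  LinearMap.coprod_inr _ _

lemma coact_comp_fst (M N : RightComod.{u, v, t} k C) :
    M.coact ∘ₗ LinearMap.fst k M.carrier N.carrier =
      (LinearMap.fst k M.carrier N.carrier).rTensor C ∘ₗ prodCoact M N := by
  refine LinearMap.prod_ext ?_ ?_
  · rw [LinearMap.comp_assoc, LinearMap.fst_comp_inl, LinearMap.comp_assoc, prodCoact_comp_inl,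
      ← LinearMap.comp_assoc, ← LinearMap.rTensor_comp, LinearMap.fst_comp_inl]
    simp
  · rw [LinearMap.comp_assoc, LinearMap.fst_comp_inr, LinearMap.comp_assoc, prodCoact_comp_inr,
      ← LinearMap.comp_assoc, ← LinearMap.rTensor_comp, LinearMap.fst_comp_inr]
    simp

lemma coact_comp_snd (M N : RightComod.{u, v, t} k C) :
    N.coact ∘ₗ LinearMap.snd k M.carrier N.carrier =
      (LinearMap.snd k M.carrier N.carrier).rTensor C ∘ₗ prodCoact M N := by
  refine LinearMap.prod_ext ?_ ?_
  · rw [LinearMap.comp_assoc, LinearMap.snd_comp_inl, LinearMap.comp_assoc, prodCoact_comp_inl,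
      ← LinearMap.comp_assoc, ← LinearMap.rTensor_comp, LinearMap.snd_comp_inl]
    simp
  · rw [LinearMap.comp_assoc, LinearMap.snd_comp_inr, LinearMap.comp_assoc, prodCoact_comp_inr,
      ← LinearMap.comp_assoc, ← LinearMap.rTensor_comp, LinearMap.snd_comp_inr]
    simp

/-- The direct sum of two comodules. -/
def prod (M N : RightComod.{u, v, t} k C) : RightComod.{u, v, t} k C where
  carrier := M.carrier × N.carrier
  coact := prodCoact M N
  coassoc := by
    refine LinearMap.prod_ext (LinearMap.ext fun m => ?_) (LinearMap.ext fun n => ?_)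
    · simp only [LinearMap.comp_apply, LinearEquiv.coe_coe]
      rw [← rTensor_assoc_rTensor (prodCoact_comp_inl M N),
        ← rTensor_lTensor_comul (prodCoact_comp_inl M N)]
      exact congrArg _ (LinearMap.congr_fun M.coassoc m)
    · simp only [LinearMap.comp_apply, LinearEquiv.coe_coe]
      rw [← rTensor_assoc_rTensor (prodCoact_comp_inr M N),
        ← rTensor_lTensor_comul (prodCoact_comp_inr M N)]
      exact congrArg _ (LinearMap.congr_fun N.coassoc n)
  coact_counit := by
    refine LinearMap.prod_ext (LinearMap.ext fun m => ?_) (LinearMap.ext fun n => ?_)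
    · simp only [LinearMap.comp_apply, LinearEquiv.coe_coe]
      rw [← apply_rid_lTensor_counit (prodCoact_comp_inl M N)]
      exact congrArg _ (LinearMap.congr_fun M.coact_counit m)
    · simp only [LinearMap.comp_apply, LinearEquiv.coe_coe]
      rw [← apply_rid_lTensor_counit (prodCoact_comp_inr M N)]
      exact congrArg _ (LinearMap.congr_fun N.coact_counit n)

/-- The binary bicone of the direct sum of two comodules. -/
def prodBicone (M N : RightComod.{u, v, t} k C) : BinaryBicone M N where
  pt := prod M N
  fst := Hom.mk (LinearMap.fst k M.carrier N.carrier) (coact_comp_fst M N)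
  snd := Hom.mk (LinearMap.snd k M.carrier N.carrier) (coact_comp_snd M N)
  inl := Hom.mk (LinearMap.inl k M.carrier N.carrier) (prodCoact_comp_inl M N)
  inr := Hom.mk (LinearMap.inr k M.carrier N.carrier) (prodCoact_comp_inr M N)
  inl_fst := hom_ext (LinearMap.fst_comp_inl k M.carrier N.carrier)
  inl_snd := hom_ext (LinearMap.snd_comp_inl k M.carrier N.carrier)
  inr_fst := hom_ext (LinearMap.fst_comp_inr k M.carrier N.carrier)
  inr_snd := hom_ext (LinearMap.snd_comp_inr k M.carrier N.carrier)

instance : HasBinaryBiproducts (RightComod.{u, v, t} k C) where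
  has_binary_biproduct M N := hasBinaryBiproduct_of_total (prodBicone M N) (hom_ext (by
    refine LinearMap.ext fun x => ?_
    change (x.1, (0 : N.carrier)) + ((0 : M.carrier), x.2) = x
    exact Prod.ext (add_zero _) (zero_add _)))

instance : Abelian (RightComod.{u, v, t} k C) where
  has_finite_products := by
    have : HasBinaryProducts (RightComod.{u, v, t} k C) := inferInstance
    exact hasFiniteProducts_of_has_binary_and_terminal

end General

/-! ### Abelianness of the category of locally finite comodules -/

section LocallyFinite

variable {k : Type u} [Field k] {E : Type v} [Category.{w} E] [Preadditive E] [Linear k E]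
  [LocallyFiniteCat k E]

instance : (IsLocallyFiniteRightComod.{u, v, w, t} k E).IsClosedUnderSubobjects where
  prop_of_mono {M N} f _ hN x := by
    have hx : FiniteDimensional k (N.component x) := hN x
    -- Comodule morphisms commute with ε_x, so they map components to components.
    have h : ∀ m ∈ M.component x, Hom.toLinearMap f m ∈ N.component x := by
      rintro _ ⟨m, rfl⟩
      exact ⟨Hom.toLinearMap f m, (act_comm f _ m).symm⟩
    exact FiniteDimensional.of_injective ((Hom.toLinearMap f).restrict h) fun a b e =>
      Subtype.ext (injective_of_mono f (congrArg Subtype.val e))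

instance : (IsLocallyFiniteRightComod.{u, v, w, t} k E).IsClosedUnderQuotients where
  prop_of_epi {M N} f _ hM x := by
    have hx : FiniteDimensional k (M.component x) := hM x
    have h : N.component x ≤ (M.component x).map (Hom.toLinearMap f) := by
      rintro _ ⟨n, rfl⟩
      obtain ⟨m, rfl⟩ := surjective_of_epi f n
      exact ⟨_, ⟨m, rfl⟩, act_comm f _ m⟩
    exact Submodule.finiteDimensional_of_le h

instance : (IsLocallyFiniteRightComod.{u, v, w, t} k E).ContainsZero where
  exists_zero := ⟨_, isZero_zeroObj, fun x => by
    have : FiniteDimensional k (zeroObj.{u, max u v w, t} k (CatCoalg k E)).carrier :=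
      inferInstanceAs (FiniteDimensional k PUnit)
    infer_instance⟩

lemma isLocallyFinite_prod {M N : RightComod.{u, max u v w, t} k (CatCoalg k E)}
    (hM : IsLocallyFiniteRightComod.{u, v, w, t} k E M)
    (hN : IsLocallyFiniteRightComod.{u, v, w, t} k E N) :
    IsLocallyFiniteRightComod.{u, v, w, t} k E (prodBicone M N).pt := by
  intro x
  have hMx : FiniteDimensional k (M.component x) := hM x
  have hNx : FiniteDimensional k (N.component x) := hN x
  have h1 : ∀ p ∈ (prodBicone M N).pt.component x,
      Hom.toLinearMap (prodBicone M N).fst p ∈ M.component x := by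
    rintro _ ⟨p, rfl⟩
    exact ⟨_, (act_comm (prodBicone M N).fst _ p).symm⟩
  have h2 : ∀ p ∈ (prodBicone M N).pt.component x,
      Hom.toLinearMap (prodBicone M N).snd p ∈ N.component x := by
    rintro _ ⟨p, rfl⟩
    exact ⟨_, (act_comm (prodBicone M N).snd _ p).symm⟩
  refine FiniteDimensional.of_injective (((Hom.toLinearMap (prodBicone M N).fst).restrict h1).prod
    ((Hom.toLinearMap (prodBicone M N).snd).restrict h2)) fun a b e => Subtype.ext ?_
  exact Prod.ext (congrArg (fun p => (p.1 : M.carrier)) e) (congrArg (fun p => (p.2 : N.carrier)) e)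

instance : (IsLocallyFiniteRightComod.{u, v, w, t} k E).IsClosedUnderBinaryProducts where
  limitsOfShape_le := by
    rintro X ⟨h⟩
    let b := prodBicone (h.diag.obj ⟨WalkingPair.left⟩) (h.diag.obj ⟨WalkingPair.right⟩)
    let p : X ⟶ h.diag.obj ⟨WalkingPair.left⟩ := h.π.app ⟨WalkingPair.left⟩
    let q : X ⟶ h.diag.obj ⟨WalkingPair.right⟩ := h.π.app ⟨WalkingPair.right⟩
    -- The point of an arbitrary product cone is compared with the explicit direct sum. A
    -- monomorphism is enough, by closure under subobjects.
    let f : X ⟶ b.pt := p ≫ b.inl + q ≫ b.inr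
    have h1 : f ≫ b.fst = p := by simp [f]
    have h2 : f ≫ b.snd = q := by simp [f]
    have : Mono f := ⟨fun a a' e => h.isLimit.hom_ext fun j => by
      obtain ⟨_ | _⟩ := j
      · change a ≫ p = a' ≫ p
        rw [← h1, ← Category.assoc, e, Category.assoc]
      · change a ≫ q = a' ≫ q
        rw [← h2, ← Category.assoc, e, Category.assoc]⟩
    exact ObjectProperty.prop_of_mono _ f
      (isLocallyFinite_prod (h.prop_diag_obj _) (h.prop_diag_obj _))

instance : Abelian (LFRightComod.{u, v, w, t} k E) :=
  have : (IsLocallyFiniteRightComod.{u, v, w, t} k E).IsClosedUnderFiniteProducts :=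
    ObjectProperty.IsClosedUnderFiniteProducts.mk'
  inferInstance

end LocallyFinite

end RightComod

/-! ### Additive structure on contramodule morphisms. -/

namespace LeftContra

section General

variable {k : Type u} [Field k] {C : Type v} [AddCommGroup C] [Module k C] [Coalgebra k C]

/-- The subgroup of morphisms of contramodules in the group of linear maps. -/
def homSubgroup (P Q : LeftContra.{u, v, t} k C) : AddSubgroup (P.carrier →ₗ[k] Q.carrier) where
  carrier := {f | ∀ F : C →ₗ[k] P.carrier, f (P.contraact F) = Q.contraact (f ∘ₗ F)}
  zero_mem' _ := by simp
  add_mem' {f g} hf hg F := by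
    rw [LinearMap.add_apply, hf, hg, LinearMap.add_comp, map_add]
  neg_mem' {f} hf F := by
    rw [LinearMap.neg_apply, hf, LinearMap.neg_comp, map_neg]

/-- Morphisms of contramodules as elements of a subgroup of the group of linear maps. -/
def homEquiv (P Q : LeftContra.{u, v, t} k C) : (P ⟶ Q) ≃ homSubgroup P Q where
  toFun f := ⟨Hom.toLinearMap f, Hom.comm f⟩
  invFun f := Hom.mk f.1 f.2
  left_inv _ := rfl
  right_inv _ := rfl

instance (P Q : LeftContra.{u, v, t} k C) : AddCommGroup (P ⟶ Q) := (homEquiv P Q).addCommGroup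

instance : Preadditive (LeftContra.{u, v, t} k C) where
  add_comp _ _ _ _ _ _ := Hom.ext (LinearMap.comp_add _ _ _)
  comp_add _ _ _ _ _ _ := Hom.ext (LinearMap.add_comp _ _ _)

end General

end LeftContra

end

theorem mainTheorem4 {k : Type u} [Field k] {E : Type v} [Category.{w} E] [Preadditive E]
    [Linear k E] [LeftStrictlyLocallyFiniteCat k E] :
    Nonempty (Abelian (LFRightComod.{u, v, w, max u v w t} k E)) ∧
    Nonempty (Abelian (LFLeftContra.{u, v, w, max u v w t} k E)) ∧
    (lfDualFunctor.{u, v, w, max v w t} k E).IsEquivalence := by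
  have hF := lfDualFunctor_isEquivalence.{u, v, w, t} (k := k) (E := E)
  -- The opposite of the abelian category of locally finite comodules is abelian; finite products,
  -- and then abelianness, pass to contramodules along the inverse equivalence.
  have : Limits.HasFiniteProducts (LFLeftContra.{u, v, w, max u v w t} k E) :=
    ⟨fun n => Adjunction.hasLimitsOfShape_of_equivalence (lfDualFunctor.{u, v, w, max v w t} k E).inv⟩
  exact ⟨⟨inferInstance⟩, ⟨abelianOfEquivalence (lfDualFunctor.{u, v, w, max v w t} k E).inv⟩, hF⟩
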